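/- All graphs are finite, simple and undirected. An independent cut of a graph $G$ is a set $S$ of vertices such that no edge of $G$ joins two vertices of $S$ and $G-S$ is disconnected. A graph is solid if it has at least three vertices and has no independent cut. A set $\mathcal H$ of subgraphs of $G$ quasi-covers $G$ if $V(\mathcal H)=\bigcup_{H\in\mathcal H}V(H)$ contains at least two vertices of every triangle of $G$. Theorem. There are an algorithm and a constant $c$ with the following property. Given a 2-connected graph $G$ of order $n$ in which every vertex lies in a triangle, and a set $\mathcal H$ of solid (not necessarily induced) subgraphs of $G$ that quasi-covers $G$, the algorithm correctly decides in time at most $2^{|\mathcal H|}\,n^{c}$ whether $G$ has an independent cut. Here an algorithm is a program of a random access machine with addition and subtraction whose running time is measured with logarithmic cost (each instruction is charged one plus the binary lengths of the numbers and addresses it handles); $G$ and the members of $\mathcal H$, listed in any order, are given by vertex vectors and adjacency matrices. -/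

import Mathlib

namespace IndepCut

/-! ### Independent cuts, solid graphs, quasi-covers -/

/-- `S` is an independent cut of `G`: no edge of `G` joins two vertices of `S`, and `G - S` is
disconnected, i.e. has two vertices that no walk of `G - S` joins. -/
def IsIndependentCut {V : Type*} (G : SimpleGraph V) (S : Set V) : Prop :=
  G.IsIndepSet S ∧ ¬ (G.induce Sᶜ).Preconnected

/-- `G` has an independent cut. -/
def HasIndependentCut {V : Type*} (G : SimpleGraph V) : Prop :=
  ∃ S : Set V, IsIndependentCut G S

/-- `G` is 2-connected: it has at least three vertices, it is connected, and it stays connected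
when any one vertex is deleted. -/
def IsTwoConnected {V : Type*} (G : SimpleGraph V) : Prop :=
  3 ≤ Nat.card V ∧ G.Connected ∧ ∀ v : V, (G.induce {v}ᶜ).Connected

/-- A non-trivial instance: 2-connected, and every vertex lies in a triangle. -/
def IsNonTrivial {V : Type*} (G : SimpleGraph V) : Prop :=
  IsTwoConnected G ∧ ∀ v : V, ∃ T : Finset V, G.IsNClique 3 T ∧ v ∈ T

/-- A (finite) graph is solid if it has order at least three and no independent cut. -/
def IsSolid {W : Type*} (H : SimpleGraph W) : Prop :=
  3 ≤ Nat.card W ∧ ¬ HasIndependentCut H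

/-- The union of the vertex sets of the members of `F`. -/
def vertexUnion {V : Type*} {G : SimpleGraph V} (F : Finset G.Subgraph) : Set V :=
  {v | ∃ H ∈ F, v ∈ H.verts}

/-- `F` quasi-covers `G`: every triangle of `G` has at least two vertices in the union of the
vertex sets of the members of `F`. -/
def QuasiCovers {V : Type*} (G : SimpleGraph V) (F : Finset G.Subgraph) : Prop :=
  ∀ T : Finset V, G.IsNClique 3 T → 2 ≤ ((T : Set V) ∩ vertexUnion F).ncard

/-! ### Random access machines with logarithmic cost -/

/-- A state of the machine: registers and arrays of natural numbers. A program mentions only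
finitely many registers and arrays; array cells are addressed indirectly. -/
structure State where
  /-- the content of each register -/
  reg : ℕ → ℕ
  /-- the content of each cell of each array -/
  arr : ℕ → ℕ → ℕ

/-- Write `x` to register `d`. -/
def State.setReg (s : State) (d x : ℕ) : State :=
  { s with reg := Function.update s.reg d x }

/-- Write `x` to cell `i` of array `A`. -/
def State.setArr (s : State) (A i x : ℕ) : State :=
  { s with arr := Function.update s.arr A (Function.update (s.arr A) i x) }

/-- Programs. The letters `d`, `a`, `b`, `r` name registers, and `A` names an array. -/
inductive Prog where
  /-- do nothing -/
  | skip : Prog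
  /-- `d := x` -/
  | const (d x : ℕ) : Prog
  /-- `d := a` -/
  | copy (d a : ℕ) : Prog
  /-- `d := a + b` -/
  | add (d a b : ℕ) : Prog
  /-- `d := max (a - b) 0` -/
  | sub (d a b : ℕ) : Prog
  /-- `d := A[a]` -/
  | load (d A a : ℕ) : Prog
  /-- `A[a] := b` -/
  | store (A a b : ℕ) : Prog
  /-- first `p`, then `q` -/
  | seq (p q : Prog) : Prog
  /-- if register `r` is non-zero then `p` else `q` -/
  | ite (r : ℕ) (p q : Prog) : Prog
  /-- while register `r` is non-zero do `p` -/
  | loop (r : ℕ) (p : Prog) : Prog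

/-- `Exec p s t s'`: started in state `s`, program `p` halts in state `s'` at total cost `t`.
Every elementary instruction and every test costs one plus the binary lengths of the numbers it
handles, addresses included. -/
inductive Exec : Prog → State → ℕ → State → Prop
  | skip (s : State) : Exec .skip s 1 s
  | const (s : State) (d x : ℕ) :
      Exec (.const d x) s (1 + x.size) (s.setReg d x)
  | copy (s : State) (d a : ℕ) :
      Exec (.copy d a) s (1 + (s.reg a).size) (s.setReg d (s.reg a))
  | add (s : State) (d a b : ℕ) :
      Exec (.add d a b) s (1 + (s.reg a).size + (s.reg b).size)
        (s.setReg d (s.reg a + s.reg b))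
  | sub (s : State) (d a b : ℕ) :
      Exec (.sub d a b) s (1 + (s.reg a).size + (s.reg b).size)
        (s.setReg d (s.reg a - s.reg b))
  | load (s : State) (d A a : ℕ) :
      Exec (.load d A a) s (1 + (s.reg a).size + (s.arr A (s.reg a)).size)
        (s.setReg d (s.arr A (s.reg a)))
  | store (s : State) (A a b : ℕ) :
      Exec (.store A a b) s (1 + (s.reg a).size + (s.reg b).size)
        (s.setArr A (s.reg a) (s.reg b))
  | seq {p q : Prog} {s s' s'' : State} {t t' : ℕ} :
      Exec p s t s' → Exec q s' t' s'' → Exec (.seq p q) s (t + t') s''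
  | ite_true {r : ℕ} {p q : Prog} {s s' : State} {t : ℕ} :
      s.reg r ≠ 0 → Exec p s t s' → Exec (.ite r p q) s (1 + (s.reg r).size + t) s'
  | ite_false {r : ℕ} {p q : Prog} {s s' : State} {t : ℕ} :
      s.reg r = 0 → Exec q s t s' → Exec (.ite r p q) s (1 + (s.reg r).size + t) s'
  | loop_done {r : ℕ} {p : Prog} {s : State} :
      s.reg r = 0 → Exec (.loop r p) s (1 + (s.reg r).size) s
  | loop_step {r : ℕ} {p : Prog} {s s' s'' : State} {t t' : ℕ} :
      s.reg r ≠ 0 → Exec p s t s' → Exec (.loop r p) s' t' s'' →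
        Exec (.loop r p) s (1 + (s.reg r).size + t + t') s''

/-- The machine is deterministic: cost and final state are determined by program and start. -/
theorem Exec.det {p : Prog} {s s₁ s₂ : State} {t₁ t₂ : ℕ}
    (h₁ : Exec p s t₁ s₁) (h₂ : Exec p s t₂ s₂) : t₁ = t₂ ∧ s₁ = s₂ := by
  induction h₁ generalizing t₂ s₂ with
  | seq _ _ ih ih' =>
    cases h₂ with
    | seq g g' =>
      obtain ⟨rfl, rfl⟩ := ih g
      obtain ⟨rfl, rfl⟩ := ih' g'
      exact ⟨rfl, rfl⟩
  | ite_true hr _ ih =>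
    cases h₂ with
    | ite_true _ g =>
      obtain ⟨rfl, rfl⟩ := ih g
      exact ⟨rfl, rfl⟩
    | ite_false hr' _ => exact absurd hr' hr
  | ite_false hr _ ih =>
    cases h₂ with
    | ite_true hr' _ => exact absurd hr hr'
    | ite_false _ g =>
      obtain ⟨rfl, rfl⟩ := ih g
      exact ⟨rfl, rfl⟩
  | loop_done hr =>
    cases h₂ with
    | loop_done _ => exact ⟨rfl, rfl⟩
    | loop_step hr' _ _ => exact absurd hr hr'
  | loop_step hr _ _ ih ih' =>
    cases h₂ with
    | loop_done hr' => exact absurd hr' hr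
    | loop_step _ g g' =>
      obtain ⟨rfl, rfl⟩ := ih g
      obtain ⟨rfl, rfl⟩ := ih' g'
      exact ⟨rfl, rfl⟩
  | _ => cases h₂; exact ⟨rfl, rfl⟩

/-- The initial state on input `w`: the words of `w` stand in array `0` from address `0` on, and
everything else is `0`. -/
def State.init (w : List ℕ) : State where
  reg _ := 0
  arr A i := if A = 0 then w.getD i 0 else 0

/-! ### Presenting an instance to the machine -/

open Classical in
/-- The 0/1 characteristic vector of a set of vertices. -/
noncomputable def vertexWords {n : ℕ} (S : Set (Fin n)) : List ℕ :=
  (List.finRange n).map fun v => if v ∈ S then 1 else 0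

open Classical in
/-- The 0/1 adjacency matrix of a relation, row by row. -/
noncomputable def adjWords {n : ℕ} (R : Fin n → Fin n → Prop) : List ℕ :=
  (List.finRange n).flatMap fun u => (List.finRange n).map fun v => if R u v then 1 else 0

/-- The input: the order `n`, the number of subgraphs, the adjacency matrix of `G`, and for each
subgraph in turn its vertex set followed by its `n × n` adjacency matrix. -/
noncomputable def encode {n : ℕ} (G : SimpleGraph (Fin n)) (Hs : List G.Subgraph) : List ℕ :=
  n :: Hs.length :: (adjWords G.Adj ++
    Hs.flatMap fun H => vertexWords H.verts ++ adjWords H.Adj)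

end IndepCut

/-!
An independent cut `S` of `G` amounts to a labelling of the vertices: label `2` on `S`, and labels `0`
and `1` on the two sides of a partition of the components of `G - S`. The constraints are that no edge
has the labels `(0, 1)`, `(1, 0)` or `(2, 2)`, and that both `0` and `1` occur
(`hasIndependentCut_iff`). Such a labelling restricts to every subgraph `H`; if `H` is solid, then `0`
and `1` do not both occur on `H` (`IsSolid.eq_of_side`). So the algorithm runs through all functions
that choose a side for each member of the family, and through all pairs `a`, `b` of vertices, and asks
for a labelling that respects the chosen sides, with label `0` at `a` and label `1` at `b`.

Once the sides are chosen, every covered vertex has only two possible labels left. So does every other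
vertex `v`: it lies in a triangle with two covered vertices, and whichever labels these two have lost,
the edges of the triangle exclude a label at `v` (`exists_excluded_of_triangle`). What remains is a
binary constraint satisfaction problem in which each variable has at most two values, that is, an
instance of 2-SAT. It is solved by eliminating vertices one after the other: if labels of `u` and `v`
leave no label for `w`, they are declared incompatible. A labelling of the later vertices that is
compatible after the elimination of `w` extends to `w`, as pairwise intersecting subsets of a set with
two elements have a common element (`exists_extension`). An additional vertex `n` with the fixed label
`2` turns the exclusion of a label into an incompatibility of two labels, and the problem has no
solution if and only if label `2` of this vertex becomes incompatible with itself. Two passes of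
elimination are made: the first one finds the excluded labels of the uncovered vertices, and the second
one decides.

The family may have exponentially many members, so that not even one look at each of them is affordable
for each choice of sides. If it has at least `n` members, they are replaced by the `n` one-element sets
of vertices, which never meet both sides and cover everything. Hence there are `2 ^ k` choices, with `k`
the minimum of `n` and the number of members, and each takes polynomial time.

The machine program is compiled from a language of nested loops over square Boolean matrices
(`Cmd.sem`, `Cmd.runs_compile`). All its loops run through all `n + 1` indices, so that the number of
steps is a polynomial that can be read off the command (`Cmd.steps_le`), and the only numbers that it
handles are indices, addresses and the position in the input, which are polynomially bounded. A driver
written for the machine itself (`runs_driver`) counts the `2 ^ k` rounds.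
-/

namespace IndepCut

/-! ### Time-bounded execution of machine programs -/

/-- Started in `s`, the program `p` halts within cost `T` in a state satisfying `Q`. -/
def Runs (p : Prog) (s : State) (T : ℕ) (Q : State → Prop) : Prop :=
  ∃ t s', Exec p s t s' ∧ t ≤ T ∧ Q s'

/-- An upper bound on the cost of one instruction whose operands are at most `B`. -/
def unitCost (B : ℕ) : ℕ := 1 + 2 * B.size

theorem State.reg_setReg_of_ne {s : State} {d x r : ℕ} (h : r ≠ d) :
    (s.setReg d x).reg r = s.reg r :=
  Function.update_of_ne h _ _

theorem State.reg_setReg_self {s : State} {d x : ℕ} : (s.setReg d x).reg d = x :=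
  Function.update_self _ _ _

theorem Runs.mono {p : Prog} {s : State} {T T' : ℕ} {Q Q' : State → Prop}
    (h : Runs p s T Q) (hT : T ≤ T') (hQ : ∀ s', Q s' → Q' s') : Runs p s T' Q' := by
  obtain ⟨t, s', he, ht, hq⟩ := h
  exact ⟨t, s', he, ht.trans hT, hQ _ hq⟩

theorem Runs.seq {p q : Prog} {s : State} {T T' : ℕ} {Q R : State → Prop}
    (h : Runs p s T Q) (h' : ∀ s', Q s' → Runs q s' T' R) :
    Runs (.seq p q) s (T + T') R := by
  obtain ⟨t, s', he, ht, hq⟩ := h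
  obtain ⟨t', s'', he', ht', hr⟩ := h' _ hq
  exact ⟨_, _, .seq he he', Nat.add_le_add ht ht', hr⟩

theorem Runs.skip {B : ℕ} {s : State} {Q : State → Prop} (hQ : Q s) :
    Runs .skip s (unitCost B) Q :=
  ⟨_, _, .skip s, by simp [unitCost], hQ⟩

theorem Runs.const {B : ℕ} {s : State} {d x : ℕ} {Q : State → Prop} (hx : x ≤ B)
    (hQ : Q (s.setReg d x)) : Runs (.const d x) s (unitCost B) Q :=
  ⟨_, _, .const s d x, by have := Nat.size_le_size hx; simp only [unitCost]; omega, hQ⟩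

theorem Runs.copy {B : ℕ} {s : State} {d a : ℕ} {Q : State → Prop} (ha : s.reg a ≤ B)
    (hQ : Q (s.setReg d (s.reg a))) : Runs (.copy d a) s (unitCost B) Q :=
  ⟨_, _, .copy s d a, by have := Nat.size_le_size ha; simp only [unitCost]; omega, hQ⟩

theorem Runs.add {B : ℕ} {s : State} {d a b : ℕ} {Q : State → Prop} (ha : s.reg a ≤ B)
    (hb : s.reg b ≤ B) (hQ : Q (s.setReg d (s.reg a + s.reg b))) :
    Runs (.add d a b) s (unitCost B) Q :=
  ⟨_, _, .add s d a b, by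
    have := Nat.size_le_size ha; have := Nat.size_le_size hb; simp only [unitCost]; omega, hQ⟩

theorem Runs.sub {B : ℕ} {s : State} {d a b : ℕ} {Q : State → Prop} (ha : s.reg a ≤ B)
    (hb : s.reg b ≤ B) (hQ : Q (s.setReg d (s.reg a - s.reg b))) :
    Runs (.sub d a b) s (unitCost B) Q :=
  ⟨_, _, .sub s d a b, by
    have := Nat.size_le_size ha; have := Nat.size_le_size hb; simp only [unitCost]; omega, hQ⟩

theorem Runs.load {B : ℕ} {s : State} {d A a : ℕ} {Q : State → Prop} (ha : s.reg a ≤ B)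
    (hb : s.arr A (s.reg a) ≤ B) (hQ : Q (s.setReg d (s.arr A (s.reg a)))) :
    Runs (.load d A a) s (unitCost B) Q :=
  ⟨_, _, .load s d A a, by
    have := Nat.size_le_size ha; have := Nat.size_le_size hb; simp only [unitCost]; omega, hQ⟩

theorem Runs.store {B : ℕ} {s : State} {A a b : ℕ} {Q : State → Prop} (ha : s.reg a ≤ B)
    (hb : s.reg b ≤ B) (hQ : Q (s.setArr A (s.reg a) (s.reg b))) :
    Runs (.store A a b) s (unitCost B) Q :=
  ⟨_, _, .store s A a b, by
    have := Nat.size_le_size ha; have := Nat.size_le_size hb; simp only [unitCost]; omega, hQ⟩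

theorem Runs.ite {B : ℕ} {s : State} {r : ℕ} {p q : Prog} {T T' : ℕ} {Q : State → Prop}
    (hr : s.reg r ≤ B) (hp : s.reg r ≠ 0 → Runs p s T Q) (hq : s.reg r = 0 → Runs q s T' Q) :
    Runs (.ite r p q) s (unitCost B + T + T') Q := by
  have h1 := Nat.size_le_size hr
  by_cases h : s.reg r = 0
  · obtain ⟨t, s', he, ht, hQ⟩ := hq h
    exact ⟨_, _, .ite_false h he, by simp only [unitCost]; omega, hQ⟩
  · obtain ⟨t, s', he, ht, hQ⟩ := hp h
    exact ⟨_, _, .ite_true h he, by simp only [unitCost]; omega, hQ⟩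

/-- A loop whose test register counts down from `N` to `0`; `I m` is the invariant that holds
when `m` rounds remain. -/
theorem Runs.countdown {B r T : ℕ} {body : Prog} (I : ℕ → State → Prop)
    (hr : ∀ m s, I m s → s.reg r = m)
    (hb : ∀ m s, m + 1 ≤ B → I (m + 1) s → Runs body s T (I m)) :
    ∀ {N : ℕ} {s : State}, N ≤ B → I N s →
      Runs (.loop r body) s (N * (unitCost B + T) + unitCost B) (I 0) := by
  intro N
  induction N with
  | zero =>
    intro s _ hI
    exact ⟨_, _, .loop_done (hr _ _ hI), by simp [hr _ _ hI, unitCost], hI⟩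
  | succ N ih =>
    intro s hN hI
    obtain ⟨t, s', he, ht, hI'⟩ := hb _ _ hN hI
    obtain ⟨t', s'', he', ht', hI''⟩ := ih (by omega) hI'
    refine ⟨_, _, .loop_step (by rw [hr _ _ hI]; omega) he he', ?_, hI''⟩
    have := Nat.size_le_size hN
    rw [hr _ _ hI, Nat.add_mul]
    simp only [unitCost] at *
    omega

/-! ### A language of loops over Boolean matrices -/

/-- `iter f j x` applies `f 0`, `f 1`, …, `f (j - 1)` in this order to `x`. -/
def iter {α : Type*} (f : ℕ → α → α) : ℕ → α → α
  | 0, x => x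
  | j + 1, x => f j (iter f j x)

theorem iter_inv {α : Type*} {f : ℕ → α → α} {n : ℕ} {x : α} (I : ℕ → α → Prop) (h0 : I 0 x)
    (h : ∀ j < n, ∀ y, I j y → I (j + 1) (f j y)) : I n (iter f n x) := by
  have : ∀ j ≤ n, I j (iter f j x) := by
    intro j
    induction j with
    | zero => intro _; exact h0
    | succ j ih => intro hj; exact h _ (by omega) _ (ih (by omega))
  exact this n le_rfl

theorem iter_keep {α : Type*} {f : ℕ → α → α} {n : ℕ} {x : α} (I : α → Prop) (h0 : I x)
    (h : ∀ j < n, ∀ y, I y → I (f j y)) : I (iter f n x) :=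
  iter_inv (fun _ => I) h0 h

/-- If round `j₀` turns `P` into `Q`, and all rounds preserve both, then the iteration turns `P`
into `Q`. -/
theorem iter_reach {α : Type*} {f : ℕ → α → α} {n : ℕ} {x : α} (P Q : α → Prop) {j₀ : ℕ}
    (hj : j₀ < n) (h0 : P x) (hP : ∀ j < n, ∀ y, P y → P (f j y))
    (hPQ : ∀ y, P y → Q (f j₀ y)) (hQ : ∀ j < n, ∀ y, Q y → Q (f j y)) : Q (iter f n x) := by
  refine (iter_inv (fun j y => P y ∧ (j₀ < j → Q y)) ⟨h0, by simp⟩ ?_).2 hj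
  rintro j hjn y ⟨hy, hy'⟩
  refine ⟨hP j hjn y hy, fun hlt => ?_⟩
  rcases Nat.lt_succ_iff_lt_or_eq.1 hlt with h | rfl
  · exact hQ j hjn y (hy' h)
  · exact hPQ y hy

/-- Commands over Boolean matrices of a common side `L`. The letter `A` names a matrix, and `p`, `q`
name index variables with values below `L`. Loop variables are de Bruijn levels: a loop with `d`
variables in scope binds the variable `d`. -/
inductive Cmd where
  /-- do nothing -/
  | skip : Cmd
  /-- `A[p, q] := b` -/
  | set (A p q : ℕ) (b : Bool) : Cmd
  /-- `A[p, q] :=` the next input word -/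
  | read (A p q : ℕ) : Cmd
  /-- first `c`, then `c'` -/
  | seq (c c' : Cmd) : Cmd
  /-- if `A[p, q]` then `c` else `c'` -/
  | ifCell (A p q : ℕ) (c c' : Cmd) : Cmd
  /-- if `p < q` then `c` else `c'` -/
  | ifLt (p q : ℕ) (c c' : Cmd) : Cmd
  /-- for the next variable from `0` to `L - 1` do `c` -/
  | all (c : Cmd) : Cmd

/-- The matrices, and the position of the next input word. -/
structure Store where
  /-- the entries of each matrix -/
  cell : ℕ → ℕ → ℕ → Bool
  /-- the position of the next input word -/
  pos : ℕ

/-- `A[p, q] := b`. -/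
def Store.set (σ : Store) (A p q : ℕ) (b : Bool) : Store :=
  { σ with cell := fun A' p' q' => if A' = A ∧ p' = p ∧ q' = q then b else σ.cell A' p' q' }

/-- The effect of a command on the store, for matrices of side `L`, input `inp`, and the values `ρ`
of the `d` variables in scope. -/
def Cmd.sem (L : ℕ) (inp : ℕ → ℕ) : Cmd → ℕ → (ℕ → ℕ) → Store → Store
  | .skip, _, _, σ => σ
  | .set A p q b, _, ρ, σ => σ.set A (ρ p) (ρ q) b
  | .read A p q, _, ρ, σ =>
    { σ.set A (ρ p) (ρ q) (decide (inp σ.pos ≠ 0)) with pos := σ.pos + 1 }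
  | .seq c c', d, ρ, σ => c'.sem L inp d ρ (c.sem L inp d ρ σ)
  | .ifCell A p q c c', d, ρ, σ =>
    if σ.cell A (ρ p) (ρ q) then c.sem L inp d ρ σ else c'.sem L inp d ρ σ
  | .ifLt p q c c', d, ρ, σ => if ρ p < ρ q then c.sem L inp d ρ σ else c'.sem L inp d ρ σ
  | .all c, d, ρ, σ => iter (fun j => c.sem L inp (d + 1) (Function.update ρ d j)) L σ

/-- Only variables in scope occur. -/
def Cmd.wellScoped : Cmd → ℕ → Bool
  | .skip, _ => true
  | .set _ p q _, d => p < d && q < d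
  | .read _ p q, d => p < d && q < d
  | .seq c c', d => c.wellScoped d && c'.wellScoped d
  | .ifCell _ p q c c', d => p < d && q < d && c.wellScoped d && c'.wellScoped d
  | .ifLt p q c c', d => p < d && q < d && c.wellScoped d && c'.wellScoped d
  | .all c, d => c.wellScoped (d + 1)

/-- An upper bound on the number of machine instructions that a command takes. -/
def Cmd.steps (L : ℕ) : Cmd → ℕ
  | .skip => 1
  | .set _ _ _ _ => 3
  | .read _ _ _ => 5
  | .seq c c' => c.steps L + c'.steps L
  | .ifCell _ _ _ c c' => 4 + c.steps L + c'.steps L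
  | .ifLt _ _ c c' => 2 + c.steps L + c'.steps L
  | .all c => 2 + L * (3 + c.steps L)

theorem Cmd.steps_le (c : Cmd) : ∃ C D, ∀ L, 1 ≤ L → c.steps L ≤ C * L ^ D := by
  induction c with
  | skip => exact ⟨1, 0, by simp [steps]⟩
  | set => exact ⟨3, 0, by simp [steps]⟩
  | read => exact ⟨5, 0, by simp [steps]⟩
  | seq c c' ih ih' | ifCell _ _ _ c c' ih ih' | ifLt _ _ c c' ih ih' =>
    obtain ⟨C, D, h⟩ := ih
    obtain ⟨C', D', h'⟩ := ih'
    refine ⟨4 + C + C', D + D', fun L hL => ?_⟩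
    have h1 : C * L ^ D ≤ C * L ^ (D + D') :=
      Nat.mul_le_mul_left _ (Nat.pow_le_pow_right hL (by omega))
    have h2 : C' * L ^ D' ≤ C' * L ^ (D + D') :=
      Nat.mul_le_mul_left _ (Nat.pow_le_pow_right hL (by omega))
    have h3 : 1 ≤ L ^ (D + D') := Nat.one_le_pow _ _ hL
    have := h L hL
    have := h' L hL
    simp only [steps, Nat.add_mul]
    omega
  | all c ih =>
    obtain ⟨C, D, h⟩ := ih
    refine ⟨5 + C, D + 1, fun L hL => ?_⟩
    have h3 : 1 ≤ L ^ D := Nat.one_le_pow _ _ hL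
    have h4 : L * c.steps L ≤ C * L ^ (D + 1) := by
      calc L * c.steps L ≤ L * (C * L ^ D) := Nat.mul_le_mul_left _ (h L hL)
        _ = C * L ^ (D + 1) := by ring
    have h5 : L ≤ L ^ (D + 1) := by rw [pow_succ]; nlinarith
    simp only [steps, Nat.add_mul, Nat.mul_add]
    omega

/-! ### Compiling the matrix language -/

/-- Register `7` receives the address of the entry with row `p` and column `q`. -/
def addrProg (p q : ℕ) : Prog :=
  .seq (.load 7 1 (2 * p + 2)) (.add 7 7 (2 * q + 2))

/-- The machine program of a command with `d` variables in scope. Variable `i` lives in register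
`2 * i + 2`, matrix `A` in array `A + 2` (row by row), and register `13 + 2 * d` is the counter of a
loop at level `d`. Register `0` holds `0`, register `1` holds `1`, register `3` holds `L`,
register `5` holds the position of the next input word; array `0` holds the input and array `1`
the addresses at which the rows of a matrix start. -/
def Cmd.compile : Cmd → ℕ → Prog
  | .skip, _ => .skip
  | .set A p q b, _ => .seq (addrProg p q) (.store (A + 2) 7 b.toNat)
  | .read A p q, _ =>
    .seq (addrProg p q) (.seq (.load 9 0 5) (.seq (.store (A + 2) 7 9) (.add 5 5 1)))
  | .seq c c', d => .seq (c.compile d) (c'.compile d)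
  | .ifCell A p q c c', d =>
    .seq (addrProg p q) (.seq (.load 7 (A + 2) 7) (.ite 7 (c.compile d) (c'.compile d)))
  | .ifLt p q c c', d =>
    .seq (.sub 7 (2 * q + 2) (2 * p + 2)) (.ite 7 (c.compile d) (c'.compile d))
  | .all c, d =>
    .seq (.copy (13 + 2 * d) 3) (.loop (13 + 2 * d)
      (.seq (.sub (2 * d + 2) 3 (13 + 2 * d))
        (.seq (c.compile (d + 1)) (.sub (13 + 2 * d) (13 + 2 * d) 1))))

/-- The machine state `s` represents the store `σ` with the `d` variables `ρ`. -/
structure Represents (L : ℕ) (inp : ℕ → ℕ) (d : ℕ) (ρ : ℕ → ℕ) (σ : Store) (s : State) : Prop where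
  zero : s.reg 0 = 0
  one : s.reg 1 = 1
  side : s.reg 3 = L
  pos : s.reg 5 = σ.pos
  var : ∀ i < d, s.reg (2 * i + 2) = ρ i
  input : ∀ i, s.arr 0 i = inp i
  row : ∀ p < L, s.arr 1 p = p * L
  cell : ∀ A p q, p < L → q < L → s.arr (A + 2) (p * L + q) = (σ.cell A p q).toNat

/-- The counters of the `d` enclosing loops have the same contents, and so has register `11`, which
counts the rounds of the driver. -/
def SameCounters (d : ℕ) (s s' : State) : Prop :=
  s'.reg 11 = s.reg 11 ∧ ∀ j < d, s'.reg (13 + 2 * j) = s.reg (13 + 2 * j)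

theorem SameCounters.trans {d : ℕ} {s s' s'' : State} (h : SameCounters d s s')
    (h' : SameCounters d s' s'') : SameCounters d s s'' :=
  ⟨h'.1.trans h.1, fun j hj => (h'.2 j hj).trans (h.2 j hj)⟩

theorem Represents.setReg {L : ℕ} {inp : ℕ → ℕ} {d : ℕ} {ρ : ℕ → ℕ} {σ : Store} {s : State}
    (h : Represents L inp d ρ σ s) {r x : ℕ} (hr : r % 2 = 1) (h5 : 5 < r) :
    Represents L inp d ρ σ (s.setReg r x) where
  zero := (State.reg_setReg_of_ne (by omega)).trans h.zero
  one := (State.reg_setReg_of_ne (by omega)).trans h.one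
  side := (State.reg_setReg_of_ne (by omega)).trans h.side
  pos := (State.reg_setReg_of_ne (by omega)).trans h.pos
  var i hi := by rw [← h.var i hi]; exact State.reg_setReg_of_ne (by omega)
  input := h.input
  row := h.row
  cell := h.cell

theorem SameCounters.setReg {d : ℕ} {s s' : State} (h : SameCounters d s s') {r x : ℕ}
    (h11 : r ≠ 11) (hr : ∀ j < d, r ≠ 13 + 2 * j) : SameCounters d s (s'.setReg r x) :=
  ⟨by rw [← h.1]; exact State.reg_setReg_of_ne h11.symm,
   fun j hj => by rw [← h.2 j hj]; exact State.reg_setReg_of_ne (hr j hj).symm⟩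

theorem SameCounters.refl (d : ℕ) (s : State) : SameCounters d s s := ⟨rfl, fun _ _ => rfl⟩

theorem address_lt {L p q : ℕ} (hp : p < L) (hq : q < L) : p * L + q < L * L := by nlinarith

theorem address_inj {L p q p' q' : ℕ} (hq : q < L) (hq' : q' < L)
    (h : p * L + q = p' * L + q') : p = p' ∧ q = q' := by
  have h1 := congrArg (· / L) h
  have hL : 0 < L := by omega
  simp only [Nat.add_comm (_ * L), Nat.add_mul_div_right _ _ hL, Nat.div_eq_of_lt hq,
    Nat.div_eq_of_lt hq', Nat.zero_add] at h1
  subst h1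
  exact ⟨rfl, by omega⟩

theorem Represents.setArr {L : ℕ} {inp : ℕ → ℕ} {d : ℕ} {ρ : ℕ → ℕ} {σ : Store} {s : State}
    (h : Represents L inp d ρ σ s) {A p q : ℕ} {b : Bool} (hq : q < L) :
    Represents L inp d ρ (σ.set A p q b) (s.setArr (A + 2) (p * L + q) b.toNat) where
  zero := h.zero
  one := h.one
  side := h.side
  pos := h.pos
  var := h.var
  input i := by
    rw [← h.input i]
    simp [State.setArr]
  row p' hp' := by
    rw [← h.row p' hp']
    simp [State.setArr]
  cell A' p' q' hp' hq' := by
    have := h.cell A' p' q' hp' hq'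
    by_cases hA : A' = A
    · subst hA
      by_cases hpq : p' = p ∧ q' = q
      · obtain ⟨rfl, rfl⟩ := hpq
        simp [State.setArr, Store.set]
      · have hne : p' * L + q' ≠ p * L + q := fun he => hpq (address_inj hq' hq he)
        simp [State.setArr, Store.set, hpq, hne, this]
    · simp [State.setArr, Store.set, hA, this]

theorem runs_addrProg {L B : ℕ} {inp : ℕ → ℕ} {d : ℕ} {ρ : ℕ → ℕ} {σ : Store} {s : State}
    (h : Represents L inp d ρ σ s) (hρ : ∀ i < d, ρ i < L) (hB : L * L ≤ B) {p q : ℕ}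
    (hp : p < d) (hq : q < d) :
    Runs (addrProg p q) s (2 * unitCost B) fun s' =>
      Represents L inp d ρ σ s' ∧ SameCounters d s s' ∧ s'.reg 7 = ρ p * L + ρ q := by
  have hp' := hρ p hp
  have hq' := hρ q hq
  have hlt := address_lt hp' hq'
  have hL : L ≤ L * L := Nat.le_mul_self L
  rw [two_mul]
  refine Runs.seq (Q := fun s' => Represents L inp d ρ σ s' ∧ SameCounters d s s' ∧
    s'.reg 7 = ρ p * L) (Runs.load ?_ ?_ ⟨h.setReg (by norm_num) (by norm_num), ?_, ?_⟩) ?_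
  · rw [h.var p hp]; omega
  · rw [h.var p hp, h.row _ hp']; omega
  · exact (SameCounters.refl d s).setReg (by norm_num) (by omega)
  · rw [h.var p hp, h.row _ hp']; simp [State.setReg]
  · rintro s' ⟨h', hc, h7⟩
    refine Runs.add ?_ ?_ ⟨h'.setReg (by norm_num) (by norm_num), ?_, ?_⟩
    · omega
    · rw [h'.var q hq]; omega
    · exact hc.setReg (by norm_num) (by omega)
    · rw [h'.var q hq, h7]; simp [State.setReg]

theorem Cmd.pos_le_sem {L : ℕ} {inp : ℕ → ℕ} (c : Cmd) :
    ∀ (d : ℕ) (ρ : ℕ → ℕ) (σ : Store),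
      σ.pos ≤ (c.sem L inp d ρ σ).pos ∧ (c.sem L inp d ρ σ).pos ≤ σ.pos + c.steps L := by
  induction c with
  | skip => intros; simp [sem]
  | set => intros; simp [sem, Store.set]
  | read => intros; simp [sem, steps]
  | seq c c' ih ih' =>
    intro d ρ σ
    have h1 := ih d ρ σ
    have h2 := ih' d ρ (c.sem L inp d ρ σ)
    simp only [sem, steps]
    omega
  | ifCell _ _ _ c c' ih ih' | ifLt _ _ c c' ih ih' =>
    intro d ρ σ
    have h1 := ih d ρ σ
    have h2 := ih' d ρ σ
    simp only [sem, steps]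
    split <;> omega
  | all c ih =>
    intro d ρ σ
    simp only [sem, steps]
    have := iter_inv (f := fun j => c.sem L inp (d + 1) (Function.update ρ d j)) (n := L) (x := σ)
      (fun j y => σ.pos ≤ y.pos ∧ y.pos ≤ σ.pos + j * c.steps L) (by simp) (by
        rintro j _ y ⟨h1, h2⟩
        have := ih (d + 1) (Function.update ρ d j) y
        rw [Nat.add_mul]
        omega)
    rw [Nat.mul_add]
    omega

/-- The compiled program has the effect that the semantics prescribes, within a cost that depends
on the command and on the size of the matrices only. -/
theorem Cmd.runs_compile {L B : ℕ} {inp : ℕ → ℕ} (hinp : ∀ i, 2 ≤ i → inp i ≤ 1) (hB : L * L ≤ B)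
    (hB1 : 1 ≤ B) (c : Cmd) :
    ∀ (d : ℕ) (ρ : ℕ → ℕ) (σ : Store) (s : State), c.wellScoped d → (∀ i < d, ρ i < L) →
      2 ≤ σ.pos → σ.pos + c.steps L ≤ B → Represents L inp d ρ σ s →
      Runs (c.compile d) s (c.steps L * unitCost B) fun s' =>
        Represents L inp d ρ (c.sem L inp d ρ σ) s' ∧ SameCounters d s s' := by
  have hLB : L ≤ B := (Nat.le_mul_self L).trans hB
  induction c with
  | skip =>
    intro d ρ σ s _ _ _ _ h
    simpa [steps, compile, sem] using Runs.skip (B := B) (s := s)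
      (Q := fun s' => Represents L inp d ρ σ s' ∧ SameCounters d s s') ⟨h, SameCounters.refl d s⟩
  | set A p q b =>
    intro d ρ σ s hs hρ _ _ h
    simp only [wellScoped, Bool.and_eq_true, decide_eq_true_eq] at hs
    refine ((runs_addrProg h hρ hB hs.1 hs.2).seq (T' := unitCost B) ?_).mono
      (by simp only [steps]; omega) (fun _ h => h)
    rintro s' ⟨h', hc, h7⟩
    have hlt := address_lt (hρ p hs.1) (hρ q hs.2)
    have hb : s'.reg b.toNat = b.toNat := by cases b <;> simp [h'.zero, h'.one]
    refine Runs.store (by omega) (by rw [hb]; exact (Bool.toNat_le b).trans hB1) ?_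
    rw [hb, h7]
    exact ⟨h'.setArr (hρ q hs.2), hc⟩
  | read A p q =>
    intro d ρ σ s hs hρ hpos hposB h
    simp only [wellScoped, Bool.and_eq_true, decide_eq_true_eq] at hs
    refine ((runs_addrProg h hρ hB hs.1 hs.2).seq
      (T' := unitCost B + (unitCost B + unitCost B)) ?_).mono
      (by simp only [steps]; omega) (fun _ h => h)
    rintro s' ⟨h', hc, h7⟩
    simp only [steps] at hposB
    have hlt := address_lt (hρ p hs.1) (hρ q hs.2)
    have hi := hinp _ hpos
    refine Runs.seq (Q := fun s' => Represents L inp d ρ σ s' ∧ SameCounters d s s' ∧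
      s'.reg 7 = ρ p * L + ρ q ∧ s'.reg 9 = inp σ.pos) (Runs.load ?_ ?_
        ⟨h'.setReg (by norm_num) (by norm_num), hc.setReg (by norm_num) (by omega), ?_, ?_⟩) ?_
    · rw [h'.pos]; omega
    · rw [h'.pos, h'.input]; omega
    · simpa [State.setReg] using h7
    · rw [h'.pos, h'.input]; simp [State.setReg]
    rintro s1 ⟨h1, hc1, h17, h19⟩
    refine Runs.seq (Q := fun s' =>
      Represents L inp d ρ (σ.set A (ρ p) (ρ q) (decide (inp σ.pos ≠ 0))) s' ∧
      SameCounters d s s') (Runs.store (by omega) (by omega) ?_) ?_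
    · have : s1.reg 9 = (decide (inp σ.pos ≠ 0)).toNat := by
        rw [h19]
        rcases Nat.le_one_iff_eq_zero_or_eq_one.1 hi with h | h <;> simp [h]
      rw [h17, this]
      exact ⟨h1.setArr (hρ q hs.2), hc1⟩
    rintro s2 ⟨h2, hc2⟩
    have hp2 : s2.reg 5 = σ.pos := h2.pos
    refine Runs.add (by omega) (by rw [h2.one]; exact hB1)
      ⟨?_, hc2.setReg (by norm_num) (by omega)⟩
    rw [hp2, h2.one]
    exact
      { zero := (State.reg_setReg_of_ne (by omega)).trans h2.zero
        one := (State.reg_setReg_of_ne (by omega)).trans h2.one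
        side := (State.reg_setReg_of_ne (by omega)).trans h2.side
        pos := by simp [State.setReg, sem]
        var := fun i hi => by rw [← h2.var i hi]; exact State.reg_setReg_of_ne (by omega)
        input := h2.input
        row := h2.row
        cell := h2.cell }
  | seq c c' ih ih' =>
    intro d ρ σ s hs hρ hpos hposB h
    simp only [wellScoped, Bool.and_eq_true] at hs
    simp only [steps] at hposB
    have hp := c.pos_le_sem (L := L) (inp := inp) d ρ σ
    refine ((ih d ρ σ s hs.1 hρ hpos (by omega) h).seq (T' := c'.steps L * unitCost B) ?_).mono
      (by simp [steps, Nat.add_mul]) (fun _ h => h)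
    rintro s' ⟨h', hc⟩
    refine (ih' d ρ _ s' hs.2 hρ (by omega) (by omega) h').mono le_rfl ?_
    rintro s'' ⟨h'', hc'⟩
    exact ⟨h'', hc.trans hc'⟩
  | ifCell A p q c c' ih ih' =>
    intro d ρ σ s hs hρ hpos hposB h
    simp only [wellScoped, Bool.and_eq_true, decide_eq_true_eq] at hs
    obtain ⟨⟨⟨hs1, hs2⟩, hs3⟩, hs4⟩ := hs
    simp only [steps] at hposB
    refine ((runs_addrProg h hρ hB hs1 hs2).seq
      (T' := unitCost B + (unitCost B + c.steps L * unitCost B + c'.steps L * unitCost B)) ?_).mono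
      (by simp only [steps, Nat.add_mul]; omega) (fun _ h => h)
    rintro s' ⟨h', hc, h7⟩
    have hlt := address_lt (hρ p hs1) (hρ q hs2)
    have hcell := h'.cell A _ _ (hρ p hs1) (hρ q hs2)
    have hle := Bool.toNat_le (σ.cell A (ρ p) (ρ q))
    refine Runs.seq (Q := fun s' => Represents L inp d ρ σ s' ∧ SameCounters d s s' ∧
      s'.reg 7 = (σ.cell A (ρ p) (ρ q)).toNat) (Runs.load (by omega) (by rw [h7, hcell]; omega)
        ⟨h'.setReg (by norm_num) (by norm_num), hc.setReg (by norm_num) (by omega), ?_⟩) ?_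
    · rw [h7, hcell]; simp [State.setReg]
    rintro s1 ⟨h1, hc1, h17⟩
    refine Runs.ite (by omega) (fun hne => ?_) (fun he => ?_)
    · have ht : σ.cell A (ρ p) (ρ q) = true := by
        rw [h17] at hne; simpa using hne
      simp only [sem, ht, if_true]
      exact (ih d ρ σ s1 hs3 hρ hpos (by omega) h1).mono le_rfl fun s'' h'' =>
        ⟨h''.1, hc1.trans h''.2⟩
    · have ht : σ.cell A (ρ p) (ρ q) = false := by
        rw [h17] at he; simpa using he
      simp only [sem, ht]
      exact (ih' d ρ σ s1 hs4 hρ hpos (by omega) h1).mono le_rfl fun s'' h'' =>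
        ⟨h''.1, hc1.trans h''.2⟩
  | ifLt p q c c' ih ih' =>
    intro d ρ σ s hs hρ hpos hposB h
    simp only [wellScoped, Bool.and_eq_true, decide_eq_true_eq] at hs
    obtain ⟨⟨⟨hs1, hs2⟩, hs3⟩, hs4⟩ := hs
    simp only [steps] at hposB
    have hp := hρ p hs1
    have hq := hρ q hs2
    refine (Runs.seq (T := unitCost B)
      (T' := unitCost B + c.steps L * unitCost B + c'.steps L * unitCost B)
      (Q := fun s' => Represents L inp d ρ σ s' ∧ SameCounters d s s' ∧
        s'.reg 7 = ρ q - ρ p) (Runs.sub ?_ ?_ ⟨h.setReg (by norm_num) (by norm_num),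
          (SameCounters.refl d s).setReg (by norm_num) (by omega), ?_⟩) ?_).mono
      (by simp only [steps, Nat.add_mul]; omega) (fun _ h => h)
    · rw [h.var q hs2]; omega
    · rw [h.var p hs1]; omega
    · rw [h.var q hs2, h.var p hs1]; simp [State.setReg]
    rintro s1 ⟨h1, hc1, h17⟩
    refine Runs.ite (by omega) (fun hne => ?_) (fun he => ?_)
    · have ht : ρ p < ρ q := by omega
      simp only [sem, ht, if_true]
      exact (ih d ρ σ s1 hs3 hρ hpos (by omega) h1).mono le_rfl fun s'' h'' =>
        ⟨h''.1, hc1.trans h''.2⟩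
    · have ht : ¬ ρ p < ρ q := by omega
      simp only [sem, ht, if_false]
      exact (ih' d ρ σ s1 hs4 hρ hpos (by omega) h1).mono le_rfl fun s'' h'' =>
        ⟨h''.1, hc1.trans h''.2⟩
  | all c ih =>
    intro d ρ σ s hs hρ hpos hposB h
    simp only [wellScoped] at hs
    simp only [steps, Nat.mul_add] at hposB
    set f : ℕ → Store → Store := fun j => c.sem L inp (d + 1) (Function.update ρ d j) with hf
    have hfpos : ∀ j, σ.pos ≤ (iter f j σ).pos ∧ (iter f j σ).pos ≤ σ.pos + j * c.steps L := by
      intro j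
      refine iter_inv (α := Store)
        (fun j y => σ.pos ≤ y.pos ∧ y.pos ≤ σ.pos + j * c.steps L) (by simp) ?_
      rintro j _ y ⟨h1, h2⟩
      have := c.pos_le_sem (L := L) (inp := inp) (d + 1) (Function.update ρ d j) y
      simp only [hf, Nat.add_mul]
      omega
    -- with `m` rounds to go, the store is the one after `L - m` rounds
    let I : ℕ → State → Prop := fun m s' => s'.reg (13 + 2 * d) = m ∧ m ≤ L ∧
      Represents L inp d ρ (iter f (L - m) σ) s' ∧ SameCounters d s s'
    refine (Runs.seq (T := unitCost B)
      (T' := L * (unitCost B + (unitCost B + (c.steps L * unitCost B + unitCost B))) + unitCost B)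
      (Q := I L) (Runs.copy (by rw [h.side]; exact hLB) ⟨?_, le_rfl, ?_, ?_⟩) ?_).mono
      (by simp only [steps]; ring_nf; omega) (fun _ h => h)
    · simp [State.setReg, h.side]
    · rw [Nat.sub_self]
      exact h.setReg (by omega) (by omega)
    · exact (SameCounters.refl d s).setReg (by omega) (by omega)
    intro s0 hs0
    refine (Runs.countdown I (fun m s h => h.1) ?_ hLB hs0).mono le_rfl ?_
    · rintro m s1 hm ⟨hr, hmL, h1, hc1⟩
      refine Runs.seq (Q := fun s' => s'.reg (13 + 2 * d) = m + 1 ∧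
        Represents L inp (d + 1) (Function.update ρ d (L - (m + 1))) (iter f (L - (m + 1)) σ) s' ∧
          SameCounters d s s') (Runs.sub (by rw [h1.side]; exact hLB) (by omega) ?_) ?_
      · rw [hr, h1.side]
        refine ⟨?_, ?_, hc1.setReg (by omega) (by omega)⟩
        · rw [← hr]; exact State.reg_setReg_of_ne (by omega)
        · exact
            { zero := (State.reg_setReg_of_ne (by omega)).trans h1.zero
              one := (State.reg_setReg_of_ne (by omega)).trans h1.one
              side := (State.reg_setReg_of_ne (by omega)).trans h1.side
              pos := (State.reg_setReg_of_ne (by omega)).trans h1.pos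
              var := fun i hi => by
                by_cases hid : i = d
                · subst hid; simp [State.setReg]
                · rw [Function.update_of_ne hid, ← h1.var i (by omega)]
                  exact State.reg_setReg_of_ne (by omega)
              input := h1.input
              row := h1.row
              cell := h1.cell }
      rintro s2 ⟨hr2, h2, hc2⟩
      have hp := hfpos (L - (m + 1))
      have hmul : (L - (m + 1)) * c.steps L + c.steps L ≤ L * c.steps L := by
        rw [← Nat.succ_mul]
        exact Nat.mul_le_mul_right _ (by omega)
      refine (ih (d + 1) _ _ s2 hs ?_ (by omega) (by omega) h2).seq ?_
      · intro i hi
        by_cases hid : i = d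
        · subst hid; simp; omega
        · rw [Function.update_of_ne hid]; exact hρ i (by omega)
      rintro s3 ⟨h3, hc3⟩
      have hr3 : s3.reg (13 + 2 * d) = m + 1 := by rw [hc3.2 d (by omega), hr2]
      refine Runs.sub (by omega) (by rw [h3.one]; exact hB1) ?_
      rw [hr3, h3.one]
      refine ⟨by simp [State.setReg], by omega, ?_, ?_⟩
      · have hLm : L - m = L - (m + 1) + 1 := by omega
        rw [hLm]
        refine Represents.setReg (r := 13 + 2 * d) ?_ (by omega) (by omega)
        exact
          { zero := h3.zero, one := h3.one, side := h3.side, pos := h3.pos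
            var := fun i hi => by
              rw [h3.var i (by omega), Function.update_of_ne (by omega)]
            input := h3.input, row := h3.row, cell := h3.cell }
      · refine SameCounters.setReg (SameCounters.trans hc2 ⟨hc3.1, fun j hj => hc3.2 j (by omega)⟩)
          (by omega) (by omega)
    · rintro s' ⟨_, _, h', hc'⟩
      exact ⟨h', hc'⟩

/-! ### The machine program around the matrix language -/

theorem Runs.seq_state {p q : Prog} {s s₁ : State} {T T' : ℕ} {R : State → Prop}
    (h : Runs p s T (· = s₁)) (h' : Runs q s₁ T' R) : Runs (.seq p q) s (T + T') R :=
  h.seq fun _ he => he ▸ h'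

/-- Register `2` receives the order `n`, register `4` the minimum `k` of `n` and the number of
subgraphs, register `3` the side `n + 1` of the matrices, and register `5` the position of the first
word of the input that has not been read. -/
def loadHeader : Prog :=
  .seq (.const 1 1) <| .seq (.load 2 0 0) <| .seq (.load 7 0 1) <| .seq (.sub 7 2 7) <|
  .seq (.sub 4 2 7) <| .seq (.add 3 2 1) (.const 5 2)

/-- Array `1` receives the multiples of register `3`. -/
def fillRowTable : Prog :=
  .seq (.const 7 0) <| .seq (.const 13 0) <| .seq (.copy 9 3) <|
  .loop 9 (.seq (.store 1 13 7) <| .seq (.add 7 7 3) <| .seq (.add 13 13 1) (.sub 9 9 1))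

/-- Register `11` receives the power of two whose exponent is in register `4`. -/
def computePower : Prog :=
  .seq (.const 11 1) <| .seq (.copy 9 4) <|
  .loop 9 (.seq (.add 11 11 11) (.sub 9 9 1))

/-- Run `decode`, then `2 ^ k` times `body`, where `k` is the minimum of the order and the number of
subgraphs, and return the entry in row `0` and column `0` of the matrix `ans`. -/
def driver (decode body : Cmd) (ans : ℕ) : Prog :=
  .seq loadHeader <| .seq fillRowTable <| .seq computePower <| .seq (decode.compile 3) <|
  .seq (.loop 11 (.seq (body.compile 3) (.sub 11 11 1))) (.load 0 (ans + 2) 0)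

/-- The values of the variables that are in scope of every command: variable `0` is the index `n` of
the extra vertex, variable `1` is the number `k` of vertex sets, variable `2` is `0`. -/
def baseVars (n k : ℕ) (i : ℕ) : ℕ := if i = 0 then n else if i = 1 then k else 0

/-- The store before anything is read. -/
def Store.init : Store where
  cell _ _ _ := false
  pos := 2

theorem runs_loadHeader {w : List ℕ} {n m B : ℕ} (hn : w.getD 0 0 = n) (hm : w.getD 1 0 = m)
    (hB : n + 2 ≤ B) :
    Runs loadHeader (State.init w) (2 * unitCost (max B m) + 5 * unitCost B) fun s =>
      s.reg 0 = 0 ∧ s.reg 1 = 1 ∧ s.reg 2 = n ∧ s.reg 3 = n + 1 ∧ s.reg 4 = min m n ∧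
      s.reg 5 = 2 ∧ s.reg 6 = 0 ∧ (∀ i, s.arr 0 i = w.getD i 0) ∧ ∀ A i, s.arr (A + 1) i = 0 := by
  refine Runs.mono (T := unitCost B + (unitCost B + (unitCost (max B m) + (unitCost (max B m) +
    (unitCost B + (unitCost B + unitCost B))))))
    (Runs.seq_state (Runs.const (by omega) rfl) <|
    Runs.seq_state (Runs.load ?_ ?_ rfl) <| Runs.seq_state (Runs.load ?_ ?_ rfl) <|
    Runs.seq_state (Runs.sub ?_ ?_ rfl) <| Runs.seq_state (Runs.sub ?_ ?_ rfl) <|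
    Runs.seq_state (Runs.add ?_ ?_ rfl) <|
    Runs.const (by omega) (Q := fun s => s.reg 0 = 0 ∧ s.reg 1 = 1 ∧ s.reg 2 = n ∧
      s.reg 3 = n + 1 ∧ s.reg 4 = min m n ∧ s.reg 5 = 2 ∧ s.reg 6 = 0 ∧
      (∀ i, s.arr 0 i = w.getD i 0) ∧ ∀ A i, s.arr (A + 1) i = 0) ?_)
    (by omega) fun _ h => h
  all_goals
    simp [State.setReg, State.init] at hn hm ⊢ <;> (try rw [hn]) <;>
      (try rw [hm]) <;> omega

theorem runs_fillRowTable {s : State} {L B : ℕ} (hL : s.reg 3 = L) (h1 : s.reg 1 = 1)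
    (hB : L * L ≤ B) (hB1 : 1 ≤ B) :
    Runs fillRowTable s (3 * unitCost B + (L * (5 * unitCost B) + unitCost B)) fun s' =>
      (∀ p < L, s'.arr 1 p = p * L) ∧ (∀ i ≤ 6, s'.reg i = s.reg i) ∧
      ∀ A ≠ 1, s'.arr A = s.arr A := by
  have hLB : L ≤ B := (Nat.le_mul_self L).trans hB
  let I : ℕ → State → Prop := fun m s' => s'.reg 9 = m ∧ m ≤ L ∧ s'.reg 13 = L - m ∧
    s'.reg 7 = (L - m) * L ∧ (∀ p < L - m, s'.arr 1 p = p * L) ∧ (∀ i ≤ 6, s'.reg i = s.reg i) ∧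
      ∀ A ≠ 1, s'.arr A = s.arr A
  refine Runs.mono (T := unitCost B + (unitCost B + (unitCost B +
    (L * (unitCost B + (unitCost B + (unitCost B + (unitCost B + unitCost B)))) + unitCost B))))
    (Runs.seq_state (Runs.const (by omega) rfl) <| Runs.seq_state (Runs.const (by omega) rfl) <|
      Runs.seq (Q := I L) (Runs.copy ?_ ?_) fun s0 h0 =>
      Runs.countdown I (fun m s h => h.1) ?_ hLB h0) (by ring_nf; omega) ?_
  · simpa [State.setReg, hL] using hLB
  · simp only [I, Nat.sub_self]
    refine ⟨by simp [State.setReg, hL], le_rfl, by simp [State.setReg], by simp [State.setReg],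
      by simp, fun i hi => ?_, fun A _ => rfl⟩
    rw [State.reg_setReg_of_ne (by omega), State.reg_setReg_of_ne (by omega),
      State.reg_setReg_of_ne (by omega)]
  · rintro m s1 hm ⟨h9, hmL, h13, h7, ht, hr, ha⟩
    have hlt : (L - (m + 1)) * L ≤ L * L := Nat.mul_le_mul_right _ (by omega)
    have h11 : s1.reg 1 = 1 := (hr 1 (by omega)).trans h1
    have h13' : s1.reg 3 = L := (hr 3 (by omega)).trans hL
    refine Runs.seq_state (Runs.store (by omega) (by omega) rfl) <|
      Runs.seq_state (Runs.add ?_ ?_ rfl) <| Runs.seq_state (Runs.add ?_ ?_ rfl) <|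
      Runs.sub ?_ ?_ ?_
    · simp only [State.setArr]; omega
    · simp only [State.setArr]; omega
    · simp [State.setReg, State.setArr]; omega
    · simp [State.setReg, State.setArr]; omega
    · simp [State.setReg, State.setArr]; omega
    · simp [State.setReg, State.setArr]; omega
    have hs : L - m = L - (m + 1) + 1 := by omega
    refine ⟨?_, by omega, ?_, ?_, ?_, ?_, ?_⟩
    · simp [State.setReg, State.setArr, h9, h11]
    · simp [State.setReg, State.setArr, h13, h11]; omega
    · simp [State.setReg, State.setArr, h7, h13', hs, Nat.add_mul]
    · intro p hp
      by_cases he : p = L - (m + 1)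
      · subst he
        simp [State.setReg, State.setArr, h13, h7]
      · simpa [State.setReg, State.setArr, h13, he] using ht p (by omega)
    · intro i hi
      rw [State.reg_setReg_of_ne (by omega), State.reg_setReg_of_ne (by omega),
        State.reg_setReg_of_ne (by omega)]
      exact hr i hi
    · intro A hA
      rw [← ha A hA]
      simp [State.setReg, State.setArr, hA]
  · rintro s' ⟨_, _, _, _, h, h', h''⟩
    exact ⟨h, h', h''⟩

theorem runs_computePower {s : State} {k B : ℕ} (hk : s.reg 4 = k) (h1 : s.reg 1 = 1)
    (hB : 2 ^ k ≤ B) :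
    Runs computePower s (2 * unitCost B + (k * (3 * unitCost B) + unitCost B)) fun s' =>
      s'.reg 11 = 2 ^ k ∧ (∀ i ≤ 6, s'.reg i = s.reg i) ∧ s'.arr = s.arr := by
  have hkB : k ≤ B := (Nat.lt_two_pow_self.le).trans hB
  have hB1 : 1 ≤ B := Nat.one_le_two_pow.trans hB
  let I : ℕ → State → Prop := fun m s' => s'.reg 9 = m ∧ m ≤ k ∧ s'.reg 11 = 2 ^ (k - m) ∧
    (∀ i ≤ 6, s'.reg i = s.reg i) ∧ s'.arr = s.arr
  refine Runs.mono (T := unitCost B + (unitCost B +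
    (k * (unitCost B + (unitCost B + unitCost B)) + unitCost B)))
    (Runs.seq_state (Runs.const hB1 rfl) <|
      Runs.seq (Q := I k) (Runs.copy ?_ ?_) fun s0 h0 =>
      Runs.countdown I (fun m s h => h.1) ?_ hkB h0) (by ring_nf; omega) ?_
  · simpa [State.setReg, hk] using hkB
  · refine ⟨by simp [State.setReg, hk], le_rfl, by simp [State.setReg], fun i hi => ?_, rfl⟩
    rw [State.reg_setReg_of_ne (by omega), State.reg_setReg_of_ne (by omega)]
  · rintro m s1 hm ⟨h9, hmk, h11, hr, ha⟩
    have hle : 2 ^ (k - (m + 1)) ≤ 2 ^ k := Nat.pow_le_pow_right (by norm_num) (by omega)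
    have h1' : s1.reg 1 = 1 := (hr 1 (by omega)).trans h1
    refine Runs.seq_state (Runs.add (by omega) (by omega) rfl) <| Runs.sub ?_ ?_ ?_
    · simp [State.setReg]; omega
    · simp [State.setReg]; omega
    have hs : k - m = k - (m + 1) + 1 := by omega
    refine ⟨?_, by omega, ?_, fun i hi => ?_, ha⟩
    · simp [State.setReg, h9, h1']
    · simp [State.setReg, h11, hs, pow_succ]; omega
    · rw [State.reg_setReg_of_ne (by omega), State.reg_setReg_of_ne (by omega)]
      exact hr i hi
  · rintro s' ⟨_, _, h, h', h''⟩
    exact ⟨by simpa using h, h', h''⟩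

/-- The driver computes what the semantics of the two commands prescribes. The number `m` of
subgraphs may exceed all other quantities, and is handled in two instructions only. -/
theorem runs_driver {w : List ℕ} {n m k B : ℕ} (hn : w.getD 0 0 = n) (hm : w.getD 1 0 = m)
    (hk : min m n = k) (hw : ∀ i, 2 ≤ i → w.getD i 0 ≤ 1) {decode body : Cmd} {ans : ℕ}
    (hdecode : decode.wellScoped 3) (hbody : body.wellScoped 3)
    (hpos : ∀ σ, (body.sem (n + 1) (w.getD · 0) 3 (baseVars n k) σ).pos = σ.pos)
    (hB : (n + 1) * (n + 1) ≤ B) (hBk : 2 ^ k ≤ B)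
    (hBs : 2 + decode.steps (n + 1) + body.steps (n + 1) + n ≤ B) :
    Runs (driver decode body ans) (State.init w)
      (2 * unitCost (max B m) + unitCost B * (15 + 5 * (n + 1) + 3 * k + decode.steps (n + 1) +
        2 ^ k * (2 + body.steps (n + 1)))) fun s =>
      s.reg 0 = ((iter (fun _ => body.sem (n + 1) (w.getD · 0) 3 (baseVars n k)) (2 ^ k)
        (decode.sem (n + 1) (w.getD · 0) 3 (baseVars n k) Store.init)).cell ans 0 0).toNat := by
  have hB1 : 1 ≤ B := Nat.one_le_two_pow.trans hBk
  have hkn : k ≤ n := by omega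
  have hρ : ∀ i < 3, baseVars n k i < n + 1 := by
    intro i _
    simp only [baseVars]
    split_ifs <;> omega
  set inp : ℕ → ℕ := (w.getD · 0) with hinp
  set σ₁ := decode.sem (n + 1) inp 3 (baseVars n k) Store.init with hσ₁
  set f : ℕ → Store → Store := fun _ => body.sem (n + 1) inp 3 (baseVars n k) with hf
  have hdpos := decode.pos_le_sem (L := n + 1) (inp := inp) 3 (baseVars n k) Store.init
  rw [← hσ₁] at hdpos
  have hi2 : Store.init.pos = 2 := rfl
  have hfpos : ∀ j, (iter f j σ₁).pos = σ₁.pos := fun j =>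
    iter_keep (fun y => y.pos = σ₁.pos) rfl fun _ _ y hy => (hpos y).trans hy
  let I : ℕ → State → Prop := fun m s => s.reg 11 = m ∧ m ≤ 2 ^ k ∧
    Represents (n + 1) inp 3 (baseVars n k) (iter f (2 ^ k - m) σ₁) s
  refine Runs.mono (T := (2 * unitCost (max B m) + 5 * unitCost B) +
    ((3 * unitCost B + ((n + 1) * (5 * unitCost B) + unitCost B)) +
    ((2 * unitCost B + (k * (3 * unitCost B) + unitCost B)) +
    (decode.steps (n + 1) * unitCost B + ((2 ^ k * (unitCost B + (body.steps (n + 1) * unitCost B +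
      unitCost B)) + unitCost B) + unitCost B)))))
    (Runs.seq (runs_loadHeader hn hm (by omega)) ?_) (by ring_nf; omega) fun _ h => h
  rintro s₁ ⟨h0, h1, h2, h3, h4, h5, h6, ha0, ha⟩
  refine Runs.seq (runs_fillRowTable h3 h1 hB hB1) ?_
  rintro s₂ ⟨ht, hr2, ha2⟩
  refine Runs.seq (runs_computePower ((hr2 4 (by omega)).trans (h4.trans hk))
    ((hr2 1 (by omega)).trans h1) hBk) ?_
  rintro s₃ ⟨h11, hr3, ha3⟩
  have hr : ∀ i ≤ 6, s₃.reg i = s₁.reg i := fun i hi => (hr3 i hi).trans (hr2 i hi)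
  have hrep : Represents (n + 1) inp 3 (baseVars n k) Store.init s₃ :=
    { zero := (hr 0 (by omega)).trans h0
      one := (hr 1 (by omega)).trans h1
      side := (hr 3 (by omega)).trans h3
      pos := (hr 5 (by omega)).trans h5
      var := fun i hi => by
        rw [hr _ (by omega)]
        interval_cases i <;> simp [baseVars, h2, h4, h6, hk]
      input := fun i => by rw [ha3, ha2 0 (by omega), ha0]
      row := fun p hp => by rw [ha3, ht p hp]
      cell := fun A p q _ _ => by
        rw [ha3, ha2 (A + 2) (by omega), ha]; simp [Store.init] }
  refine Runs.seq
    (Cmd.runs_compile hw hB hB1 decode 3 _ _ _ hdecode hρ (by omega) (by omega) hrep) ?_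
  rintro s₄ ⟨h4rep, h4c⟩
  refine Runs.seq (Runs.countdown I (fun m s h => h.1) ?_ hBk
    ⟨h4c.1.trans h11, le_rfl, by rw [Nat.sub_self]; exact h4rep⟩) ?_
  · rintro j s₅ hj ⟨hr5, hj5, h5rep⟩
    have hp := hfpos (2 ^ k - (j + 1))
    refine Runs.seq (Cmd.runs_compile hw hB hB1 body 3 _ _ _ hbody hρ (by omega) (by omega)
      h5rep) ?_
    rintro s₆ ⟨h6rep, h6c⟩
    have h611 : s₆.reg 11 = j + 1 := h6c.1.trans hr5
    refine Runs.sub (by omega) (by rw [h6rep.one]; exact hB1) ?_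
    rw [h6rep.one, h611]
    have hs : 2 ^ k - j = 2 ^ k - (j + 1) + 1 := by omega
    refine ⟨State.reg_setReg_self, by omega, ?_⟩
    rw [hs]
    exact h6rep.setReg (by omega) (by omega)
  · rintro s₇ ⟨_, _, h7rep⟩
    have hc := h7rep.cell ans 0 0 (by omega) (by omega)
    rw [Nat.zero_mul, Nat.add_zero] at hc
    refine Runs.load (by rw [h7rep.zero]; omega)
      (by rw [h7rep.zero, hc]; exact (Bool.toNat_le _).trans hB1) ?_
    rw [h7rep.zero, hc]
    exact State.reg_setReg_self

/-! ### What commands leave unchanged -/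

/-- The command changes the matrix `A`. -/
def Cmd.writes (A : ℕ) : Cmd → Bool
  | .skip => false
  | .set A' _ _ _ => A' == A
  | .read A' _ _ => A' == A
  | .seq c c' => c.writes A || c'.writes A
  | .ifCell _ _ _ c c' => c.writes A || c'.writes A
  | .ifLt _ _ c c' => c.writes A || c'.writes A
  | .all c => c.writes A

/-- The command consumes no input. -/
def Cmd.readFree : Cmd → Bool
  | .skip => true
  | .set _ _ _ _ => true
  | .read _ _ _ => false
  | .seq c c' => c.readFree && c'.readFree
  | .ifCell _ _ _ c c' => c.readFree && c'.readFree
  | .ifLt _ _ c c' => c.readFree && c'.readFree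
  | .all c => c.readFree

/-- The only changes that the command makes to matrices are from `false` to `true`. -/
def Cmd.raises : Cmd → Bool
  | .skip => true
  | .set _ _ _ b => b
  | .read _ _ _ => false
  | .seq c c' => c.raises && c'.raises
  | .ifCell _ _ _ c c' => c.raises && c'.raises
  | .ifLt _ _ c c' => c.raises && c'.raises
  | .all c => c.raises

/-- Every entry that is `true` in `σ` is `true` in `τ`. -/
def Store.Below (σ τ : Store) : Prop :=
  ∀ A p q, σ.cell A p q = true → τ.cell A p q = true

theorem Store.Below.refl (σ : Store) : σ.Below σ := fun _ _ _ h => h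

theorem Store.Below.trans {σ τ υ : Store} (h : σ.Below τ) (h' : τ.Below υ) : σ.Below υ :=
  fun A p q hσ => h' A p q (h A p q hσ)

section

variable {L : ℕ} {inp : ℕ → ℕ}

theorem Cmd.sem_cell_of_not_writes {A : ℕ} (c : Cmd) :
    ∀ (d : ℕ) (ρ : ℕ → ℕ) (σ : Store), c.writes A = false →
      (c.sem L inp d ρ σ).cell A = σ.cell A := by
  induction c with
  | skip => intros; rfl
  | set A' p q b | read A' p q =>
    intro d ρ σ h
    have hA : A ≠ A' := by rintro rfl; simp [writes] at h
    simp [sem, Store.set, hA]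
  | seq c c' ih ih' =>
    intro d ρ σ h
    simp only [writes, Bool.or_eq_false_iff] at h
    simp only [sem, ih' _ _ _ h.2, ih _ _ _ h.1]
  | ifCell _ _ _ c c' ih ih' | ifLt _ _ c c' ih ih' =>
    intro d ρ σ h
    simp only [writes, Bool.or_eq_false_iff] at h
    simp only [sem]
    split
    · exact ih _ _ _ h.1
    · exact ih' _ _ _ h.2
  | all c ih =>
    intro d ρ σ h
    exact iter_keep (fun y => y.cell A = σ.cell A) rfl fun j _ y hy => (ih _ _ y h).trans hy

theorem Cmd.sem_pos_of_readFree (c : Cmd) :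
    ∀ (d : ℕ) (ρ : ℕ → ℕ) (σ : Store), c.readFree → (c.sem L inp d ρ σ).pos = σ.pos := by
  induction c with
  | skip => intros; rfl
  | set => intros; rfl
  | read => intro _ _ _ h; simp [readFree] at h
  | seq c c' ih ih' =>
    intro d ρ σ h
    simp only [readFree, Bool.and_eq_true] at h
    simp only [sem, ih' _ _ _ h.2, ih _ _ _ h.1]
  | ifCell _ _ _ c c' ih ih' | ifLt _ _ c c' ih ih' =>
    intro d ρ σ h
    simp only [readFree, Bool.and_eq_true] at h
    simp only [sem]
    split
    · exact ih _ _ _ h.1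
    · exact ih' _ _ _ h.2
  | all c ih =>
    intro d ρ σ h
    exact iter_keep (fun y => y.pos = σ.pos) rfl fun j _ y hy => (ih _ _ y h).trans hy

theorem Cmd.below_sem (c : Cmd) :
    ∀ (d : ℕ) (ρ : ℕ → ℕ) (σ : Store), c.raises → σ.Below (c.sem L inp d ρ σ) := by
  induction c with
  | skip => intro d ρ σ _; exact .refl _
  | set A p q b =>
    intro d ρ σ h A' p' q' hc
    simp only [raises] at h
    simp only [sem, Store.set, h]
    split
    · rfl
    · exact hc
  | read => intro _ _ _ h; simp [raises] at h
  | seq c c' ih ih' =>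
    intro d ρ σ h
    simp only [raises, Bool.and_eq_true] at h
    exact (ih _ _ _ h.1).trans (ih' _ _ _ h.2)
  | ifCell _ _ _ c c' ih ih' | ifLt _ _ c c' ih ih' =>
    intro d ρ σ h
    simp only [raises, Bool.and_eq_true] at h
    simp only [sem]
    split
    · exact ih _ _ _ h.1
    · exact ih' _ _ _ h.2
  | all c ih =>
    intro d ρ σ h
    exact iter_keep (fun y => σ.Below y) (.refl _) fun j _ y hy => hy.trans (ih _ _ y h)

/-- If the body of a loop only raises entries, preserves `P`, and sets an entry in round `j` whenever
`P` holds, then the loop sets the entry. -/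
theorem Cmd.sem_all_sets {c : Cmd} (hc : c.raises) (P : Store → Prop) {d : ℕ} {ρ : ℕ → ℕ}
    {σ : Store} {j A p q : ℕ} (hj : j < L) (h0 : P σ)
    (hP : ∀ j y, P y → P (c.sem L inp (d + 1) (Function.update ρ d j) y))
    (h : ∀ y, P y → (c.sem L inp (d + 1) (Function.update ρ d j) y).cell A p q = true) :
    ((Cmd.all c).sem L inp d ρ σ).cell A p q = true :=
  iter_reach P (fun y => y.cell A p q = true) hj h0 (fun j _ y hy => hP j y hy) h
    fun _ _ y hy => c.below_sem _ _ y hc A p q hy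

/-- Run a list of commands in turn. -/
def Cmd.block : List Cmd → Cmd
  | [] => .skip
  | c :: l => .seq c (block l)

theorem Cmd.sem_block_keep {l : List Cmd} {d : ℕ} {ρ : ℕ → ℕ} (I : Store → Prop)
    (h : ∀ c ∈ l, ∀ y, I y → I (c.sem L inp d ρ y)) :
    ∀ σ, I σ → I ((block l).sem L inp d ρ σ) := by
  induction l with
  | nil => exact fun _ h => h
  | cons c l ih =>
    intro σ hσ
    exact ih (fun c' hc' => h c' (List.mem_cons_of_mem _ hc')) _ (h c List.mem_cons_self _ hσ)

theorem Cmd.sem_block_reach {l : List Cmd} {d : ℕ} {ρ : ℕ → ℕ} (P Q : Store → Prop) {c : Cmd}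
    (hc : c ∈ l) (hP : ∀ c ∈ l, ∀ y, P y → P (c.sem L inp d ρ y))
    (hPQ : ∀ y, P y → Q (c.sem L inp d ρ y)) (hQ : ∀ c ∈ l, ∀ y, Q y → Q (c.sem L inp d ρ y)) :
    ∀ σ, P σ → Q ((block l).sem L inp d ρ σ) := by
  induction l with
  | nil => simp at hc
  | cons c' l ih =>
    intro σ hσ
    rcases List.mem_cons.1 hc with rfl | hc
    · exact sem_block_keep Q (fun c' hc' => hQ c' (List.mem_cons_of_mem _ hc')) _ (hPQ _ hσ)
    · exact ih hc (fun c' hc' => hP c' (List.mem_cons_of_mem _ hc'))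
        (fun c' hc' => hQ c' (List.mem_cons_of_mem _ hc')) _ (hP _ List.mem_cons_self _ hσ)

end

/-! ### The commands of the algorithm -/

/-- Whether the ends of an edge may not have the labels `c` and `d`. The labels `0` and `1` stand for
the two sides of a cut, and `2` for the vertices of the cut. -/
def clash (c d : Fin 3) : Bool :=
  (c == 0 && d == 1) || (c == 1 && d == 0) || (c == 2 && d == 2)

/-- The name of the matrix of the pairs `(u, v)` for which the labels `c` of `u` and `d` of `v` are
known to be incompatible. Matrix `0` holds the adjacency matrix of the graph, matrix `1` the
characteristic vectors of the vertex sets, matrix `3` (in row `n`) the side that is chosen for each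
vertex set, and matrix `4` (in row `0` and column `0`) the answer. -/
def bad (c d : Fin 3) : ℕ := 6 + 3 * c + d

theorem bad_inj {c d c' d' : Fin 3} : bad c d = bad c' d' ↔ c = c' ∧ d = d' := by
  revert c d c' d'; decide

/-- All pairs of labels. -/
def labelPairs : List (Fin 3 × Fin 3) := List.finRange 3 ×ˢ List.finRange 3

theorem mem_labelPairs (x : Fin 3 × Fin 3) : x ∈ labelPairs := by
  revert x; decide

/-- Forget all incompatibilities. -/
def clearBad : Cmd :=
  .all <| .all <| .block <| labelPairs.map fun x => .set (bad x.1 x.2) 5 6 false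

/-- Note the incompatibilities along edges. -/
def noteEdges : Cmd :=
  .all <| .all <| .ifCell 0 5 6
    (.block <| (labelPairs.filter fun x => clash x.1 x.2).map fun x => .set (bad x.1 x.2) 5 6 true)
    .skip

/-- Exclude label `c` at the vertex in variable `v`, as incompatible with the label `2` of the extra
vertex `n`. -/
def exclude (c : Fin 3) (v : ℕ) : Cmd := .set (bad 2 c) 0 v true

/-- Exclude one of the two sides at all vertices of a vertex set. -/
def noteSides : Cmd :=
  .all <| .all <| .ifCell 1 5 6 (.ifCell 3 0 5 (exclude 0 6) (exclude 1 6)) .skip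

/-- Require label `0` at the vertex in variable `3` and label `1` at the vertex in variable `4`. -/
def noteEnds : Cmd := .block [exclude 1 3, exclude 2 3, exclude 0 4, exclude 2 4]

/-- Proceed if label `e` of the vertex in variable `5` is excluded, or incompatible with label `c` of
the vertex in variable `6`, or with label `d` of the vertex in variable `7`. -/
def ifBlocked (c d e : Fin 3) (X : Cmd) : Cmd :=
  .ifCell (bad 2 e) 0 5 X (.ifCell (bad c e) 6 5 X (.ifCell (bad d e) 7 5 X .skip))

/-- Labels of two vertices become incompatible if they leave no label for a third vertex. -/
def resolve (c d : Fin 3) : Cmd :=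
  ifBlocked c d 0 <| ifBlocked c d 1 <| ifBlocked c d 2 <| .set (bad c d) 6 7 true

/-- Derive all incompatibilities that the vertex in variable `5` forces on pairs of vertices. -/
def eliminate : Cmd :=
  .all <| .all <| .block <| labelPairs.map fun x => resolve x.1 x.2

/-- Write down the incompatibilities that are given. -/
def setup : Cmd := .seq clearBad <| .seq noteEdges <| .seq noteSides noteEnds

/-- Set the answer to `true` if there is a labelling with the chosen sides that gives label `0` to the
vertex in variable `3` and label `1` to the vertex in variable `4`. -/
def trial : Cmd :=
  .seq setup <| .seq (.all eliminate) <| .seq (.all eliminate) <|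
  .ifCell (bad 2 2) 0 0 .skip (.set 4 2 2 true)

/-- Binary increment of the vector of sides; the entry `(n, n)` of matrix `5` is the carry. -/
def increment : Cmd :=
  .seq (.set 5 0 0 true) <| .all <| .ifCell 5 0 0
    (.ifCell 3 0 3 (.set 3 0 3 false) (.seq (.set 3 0 3 true) (.set 5 0 0 false))) .skip

/-- Try the current vector of sides, and move on to the next one. -/
def round : Cmd := .seq (.all (.all trial)) increment

/-- Read a row of `n` entries into the row in variable `p`; `d` variables are in scope. -/
def readRow (A p d : ℕ) : Cmd := .all (.ifLt d 0 (.read A p d) .skip)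

/-- Read `n` rows of `n` entries; `d` variables are in scope. -/
def readMatrix (A d : ℕ) : Cmd := .all (.ifLt d 0 (readRow A d (d + 1)) .skip)

/-- Read the graph, and the vertex sets of the subgraphs if there are fewer than `n` of them; otherwise
take the `n` sets that consist of a single vertex. The adjacency matrices of the subgraphs go to
matrix `2`, which is not used. -/
def decode : Cmd :=
  .seq (readMatrix 0 3) <| .ifLt 1 0
    (.all (.ifLt 3 1 (.seq (readRow 1 3 4) (readMatrix 2 4)) .skip))
    (.all (.ifLt 3 0 (.set 1 3 3 true) .skip))

theorem wellScoped_decode : decode.wellScoped 3 = true := by decide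

theorem wellScoped_round : round.wellScoped 3 = true := by decide +kernel

theorem readFree_round : round.readFree = true := by decide +kernel

/-! ### One trial -/

/-- The labels that `f` gives to the vertices `0`, …, `n` are not known to be incompatible. -/
def Avoids (n : ℕ) (f : ℕ → Fin 3) (σ : Store) : Prop :=
  ∀ u ≤ n, ∀ v ≤ n, σ.cell (bad (f u) (f v)) u v = false

/-- The labelling `f` meets the constraints of a trial: the extra vertex `n` and the vertices `a` and
`b` have the labels `2`, `0` and `1`, adjacent vertices have compatible labels, and no vertex set
contains a vertex of the side opposite to the one chosen for the set. -/
structure Admissible (n : ℕ) (σ : Store) (a b : ℕ) (f : ℕ → Fin 3) : Prop where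
  root : f n = 2
  left : f a = 0
  right : f b = 1
  edge : ∀ u ≤ n, ∀ v ≤ n, σ.cell 0 u v = true → clash (f u) (f v) = false
  side : ∀ i ≤ n, ∀ v ≤ n, σ.cell 1 i v = true → f v ≠ if σ.cell 3 n i then 0 else 1

theorem Avoids.set {n : ℕ} {f : ℕ → Fin 3} {σ : Store} (h : Avoids n f σ) {c d : Fin 3} {p q : ℕ}
    (hcd : ¬(f p = c ∧ f q = d)) : Avoids n f (σ.set (bad c d) p q true) := by
  intro u hu v hv
  simp only [Store.set, bad_inj]
  split
  · next he =>
    obtain ⟨⟨h1, h2⟩, rfl, rfl⟩ := he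
    exact absurd ⟨h1, h2⟩ hcd
  · exact h u hu v hv

section

variable {n : ℕ} {inp : ℕ → ℕ}

theorem sem_clearBad {d : ℕ} (hd : d = 5) {ρ : ℕ → ℕ} {σ : Store} {u v : ℕ} (hu : u ≤ n)
    (hv : v ≤ n) (c e : Fin 3) :
    (clearBad.sem (n + 1) inp d ρ σ).cell (bad c e) u v = false := by
  subst hd
  let Q : Store → Prop := fun y => y.cell (bad c e) u v = false
  have hQ : ∀ (ρ : ℕ → ℕ), ∀ c ∈ labelPairs.map fun x => Cmd.set (bad x.1 x.2) 5 6 false, ∀ y, Q y →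
      Q (c.sem (n + 1) inp 7 ρ y) := by
    intro ρ c' hc' y hy
    obtain ⟨x, -, rfl⟩ := List.mem_map.1 hc'
    simp only [Cmd.sem, Store.set, Q]
    split
    · rfl
    · exact hy
  refine iter_reach (fun _ => True) Q (Nat.lt_succ_of_le hu) trivial (fun _ _ _ _ => trivial) ?_ ?_
  · intro y _
    refine iter_reach (fun _ => True) Q (Nat.lt_succ_of_le hv) trivial
      (fun _ _ _ _ => trivial) ?_ ?_
    · intro y _
      refine Cmd.sem_block_reach (fun _ => True) Q (List.mem_map.2 ⟨(c, e), mem_labelPairs _, rfl⟩)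
        (fun _ _ _ _ => trivial) ?_ (hQ _) _ trivial
      intro y _
      simp [Cmd.sem, Store.set, Q]
    · exact fun j _ y hy => Cmd.sem_block_keep Q (hQ _) _ hy
  · exact fun j _ y hy => iter_keep Q hy fun j _ y hy => Cmd.sem_block_keep Q (hQ _) _ hy

theorem sem_noteEdges_avoids {ρ : ℕ → ℕ} {σ : Store} {f : ℕ → Fin 3} (h : Avoids n f σ)
    (hf : ∀ u ≤ n, ∀ v ≤ n, σ.cell 0 u v = true → clash (f u) (f v) = false) :
    Avoids n f (noteEdges.sem (n + 1) inp 5 ρ σ) := by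
  let I : Store → Prop := fun y => y.cell 0 = σ.cell 0 ∧ Avoids n f y
  refine (iter_keep I ⟨rfl, h⟩ fun u hu y hy => iter_keep I hy fun v hv y hy => ?_).2
  simp only [Cmd.sem]
  split
  · next hc =>
    refine ⟨(Cmd.sem_cell_of_not_writes _ _ _ _ (by decide)).trans hy.1,
      Cmd.sem_block_keep (Avoids n f) ?_ _ hy.2⟩
    intro c hc' y' hy'
    simp only [List.mem_map, List.mem_filter] at hc'
    obtain ⟨x, ⟨-, hx⟩, rfl⟩ := hc'
    refine hy'.set fun hfx => ?_
    have hfuv := hf u (by omega) v (by omega) (by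
      rw [← hy.1]; simpa using hc)
    simp at hfx
    rw [hfx.1, hfx.2, hx] at hfuv
    simp at hfuv
  · exact hy

theorem raises_noteSides : noteSides.raises = true := by decide

theorem raises_noteEnds : noteEnds.raises = true := by decide

theorem raises_eliminate : eliminate.raises = true := by decide +kernel

theorem sem_noteEdges_cell {ρ : ℕ → ℕ} {σ : Store} {u v : ℕ} (hu : u ≤ n) (hv : v ≤ n)
    (huv : σ.cell 0 u v = true) {c d : Fin 3} (hcd : clash c d = true) :
    (noteEdges.sem (n + 1) inp 5 ρ σ).cell (bad c d) u v = true := by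
  let P : Store → Prop := fun y => y.cell 0 = σ.cell 0
  have hP : ∀ (c : Cmd) (d : ℕ) (ρ : ℕ → ℕ) (y : Store), c.writes 0 = false → P y →
      P (c.sem (n + 1) inp d ρ y) := fun c d ρ y hc hy =>
    (Cmd.sem_cell_of_not_writes _ _ _ _ hc).trans hy
  refine Cmd.sem_all_sets (by decide) P (Nat.lt_succ_of_le hu) rfl
    (fun _ _ => hP _ _ _ _ (by decide)) fun y hy =>
    Cmd.sem_all_sets (by decide) P (Nat.lt_succ_of_le hv) hy (fun _ _ => hP _ _ _ _ (by decide))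
    fun y hy => ?_
  have huv' : y.cell 0 u v = true := by rw [hy, huv]
  simp only [Cmd.sem, Function.update_apply]
  simp only [huv', reduceIte, Nat.reduceEqDiff]
  refine Cmd.sem_block_reach (fun _ => True) (fun y => y.cell (bad c d) u v = true)
    (List.mem_map.2 ⟨(c, d), List.mem_filter.2 ⟨mem_labelPairs _, hcd⟩, rfl⟩)
    (fun _ _ _ _ => trivial) ?_ ?_ _ trivial
  · intro y _
    simp [Cmd.sem, Store.set]
  · intro c' hc' y hy
    simp only [List.mem_map] at hc'
    obtain ⟨x, -, rfl⟩ := hc'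
    exact Cmd.below_sem (.set _ _ _ true) _ _ y rfl _ _ _ hy

theorem sem_noteSides_avoids {ρ : ℕ → ℕ} (hρ : ρ 0 = n) {σ : Store} {f : ℕ → Fin 3}
    (h : Avoids n f σ)
    (hf : ∀ i ≤ n, ∀ v ≤ n, σ.cell 1 i v = true → f v ≠ if σ.cell 3 n i then 0 else 1) :
    Avoids n f (noteSides.sem (n + 1) inp 5 ρ σ) := by
  let I : Store → Prop := fun y => y.cell 1 = σ.cell 1 ∧ y.cell 3 = σ.cell 3 ∧ Avoids n f y
  refine (iter_keep I ⟨rfl, rfl, h⟩ fun i hi y hy => iter_keep I hy fun v hv y hy => ?_).2.2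
  refine ⟨(Cmd.sem_cell_of_not_writes _ _ _ _ (by decide)).trans hy.1,
    (Cmd.sem_cell_of_not_writes _ _ _ _ (by decide)).trans hy.2.1, ?_⟩
  have := hf i (by omega) v (by omega)
  rw [← hy.1, ← hy.2.1] at this
  simp only [Cmd.sem, exclude, Function.update_apply]
  simp only [reduceIte, Nat.reduceEqDiff, OfNat.zero_ne_ofNat, hρ]
  split
  · next hc =>
    split
    · next hb => exact hy.2.2.set fun hfx => by simpa [hb, hfx.2] using this hc
    · next hb => exact hy.2.2.set fun hfx => by simpa [hb, hfx.2] using this hc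
  · exact hy.2.2

theorem sem_noteSides_cell {ρ : ℕ → ℕ} (hρ : ρ 0 = n) {σ : Store} {i v : ℕ} (hi : i ≤ n)
    (hv : v ≤ n) (hiv : σ.cell 1 i v = true) :
    (noteSides.sem (n + 1) inp 5 ρ σ).cell (bad 2 (if σ.cell 3 n i then 0 else 1)) n v = true := by
  let P : Store → Prop := fun y => y.cell 1 = σ.cell 1 ∧ y.cell 3 = σ.cell 3
  have hP : ∀ (c : Cmd) (d : ℕ) (ρ : ℕ → ℕ) (y : Store), c.writes 1 = false → c.writes 3 = false →
      P y → P (c.sem (n + 1) inp d ρ y) := fun c d ρ y hc hc' hy =>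
    ⟨(Cmd.sem_cell_of_not_writes _ _ _ _ hc).trans hy.1,
      (Cmd.sem_cell_of_not_writes _ _ _ _ hc').trans hy.2⟩
  refine Cmd.sem_all_sets (by decide) P (Nat.lt_succ_of_le hi) ⟨rfl, rfl⟩
    (fun _ _ => hP _ _ _ _ (by decide) (by decide)) fun y hy =>
    Cmd.sem_all_sets (by decide) P (Nat.lt_succ_of_le hv) hy
    (fun _ _ => hP _ _ _ _ (by decide) (by decide)) fun y hy => ?_
  have hiv' : y.cell 1 i v = true := by rw [hy.1, hiv]
  simp only [Cmd.sem, exclude, Function.update_apply]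
  simp only [hiv', reduceIte, Nat.reduceEqDiff, OfNat.zero_ne_ofNat, hρ, hy.2]
  split <;> simp [Store.set]

theorem sem_noteEnds_avoids {ρ : ℕ → ℕ} {σ : Store} {f : ℕ → Fin 3} (h : Avoids n f σ)
    (ha : f (ρ 3) = 0) (hb : f (ρ 4) = 1) :
    Avoids n f (noteEnds.sem (n + 1) inp 5 ρ σ) := by
  simp only [noteEnds, Cmd.block, Cmd.sem, exclude]
  exact (((h.set (by simp [ha])).set (by simp [ha])).set (by simp [hb])).set (by simp [hb])

theorem sem_noteEnds_cell {ρ : ℕ → ℕ} (hρ : ρ 0 = n) {σ : Store} :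
    let τ := noteEnds.sem (n + 1) inp 5 ρ σ
    (∀ c : Fin 3, c ≠ 0 → τ.cell (bad 2 c) n (ρ 3) = true) ∧
      ∀ c : Fin 3, c ≠ 1 → τ.cell (bad 2 c) n (ρ 4) = true := by
  constructor <;>
    · intro c
      fin_cases c <;> simp [noteEnds, Cmd.block, Cmd.sem, exclude, Store.set, hρ]

theorem sem_setup_avoids {ρ : ℕ → ℕ} (hρ : ρ 0 = n) {σ : Store} {f : ℕ → Fin 3}
    (hf : Admissible n σ (ρ 3) (ρ 4) f) : Avoids n f (setup.sem (n + 1) inp 5 ρ σ) := by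
  refine sem_noteEnds_avoids (sem_noteSides_avoids hρ (sem_noteEdges_avoids ?_ ?_) ?_)
    hf.left hf.right
  · exact fun u hu v hv => sem_clearBad rfl hu hv _ _
  · rw [Cmd.sem_cell_of_not_writes clearBad _ _ _ (by decide)]
    exact hf.edge
  · rw [Cmd.sem_cell_of_not_writes noteEdges _ _ _ (by decide),
      Cmd.sem_cell_of_not_writes clearBad _ _ _ (by decide),
      Cmd.sem_cell_of_not_writes noteEdges _ _ _ (by decide),
      Cmd.sem_cell_of_not_writes clearBad _ _ _ (by decide)]
    exact hf.side

theorem sem_setup_edge {ρ : ℕ → ℕ} {σ : Store} {u v : ℕ} (hu : u ≤ n) (hv : v ≤ n)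
    (huv : σ.cell 0 u v = true) {c d : Fin 3} (hcd : clash c d = true) :
    (setup.sem (n + 1) inp 5 ρ σ).cell (bad c d) u v = true := by
  refine Cmd.below_sem noteEnds _ _ _ raises_noteEnds _ _ _
    (Cmd.below_sem noteSides _ _ _ raises_noteSides _ _ _ (sem_noteEdges_cell hu hv ?_ hcd))
  rw [Cmd.sem_cell_of_not_writes clearBad _ _ _ (by decide)]
  exact huv

theorem sem_setup_side {ρ : ℕ → ℕ} (hρ : ρ 0 = n) {σ : Store} {i v : ℕ} (hi : i ≤ n) (hv : v ≤ n)
    (hiv : σ.cell 1 i v = true) :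
    ∃ c : Fin 3, c ≠ 2 ∧ (setup.sem (n + 1) inp 5 ρ σ).cell (bad 2 c) n v = true := by
  refine ⟨_, ?_, Cmd.below_sem noteEnds _ _ _ raises_noteEnds _ _ _
    (sem_noteSides_cell hρ hi hv ?_)⟩
  · split <;> decide
  · rw [Cmd.sem_cell_of_not_writes noteEdges _ _ _ (by decide),
      Cmd.sem_cell_of_not_writes clearBad _ _ _ (by decide)]
    exact hiv

/-! ### Elimination of vertices -/

/-- Given label `c` at `u` and label `d` at `v`, no label is left for `w`. -/
def Blocked (n : ℕ) (σ : Store) (w u v : ℕ) (c d : Fin 3) : Prop :=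
  ∀ e : Fin 3, σ.cell (bad 2 e) n w = true ∨ σ.cell (bad c e) u w = true ∨
    σ.cell (bad d e) v w = true

theorem Blocked.mono {σ τ : Store} (h : σ.Below τ) {w u v : ℕ} {c d : Fin 3}
    (hb : Blocked n σ w u v c d) : Blocked n τ w u v c d :=
  fun e => (hb e).imp (h _ _ _) (Or.imp (h _ _ _) (h _ _ _))

open Classical in
theorem sem_resolve {d' : ℕ} {ρ : ℕ → ℕ} (hρ : ρ 0 = n) {σ : Store} {c d : Fin 3} :
    (resolve c d).sem (n + 1) inp d' ρ σ =
      if Blocked n σ (ρ 5) (ρ 6) (ρ 7) c d then σ.set (bad c d) (ρ 6) (ρ 7) true else σ := by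
  have h : ∀ (e : Fin 3) (X : Cmd), (ifBlocked c d e X).sem (n + 1) inp d' ρ σ =
      if σ.cell (bad 2 e) n (ρ 5) = true ∨ σ.cell (bad c e) (ρ 6) (ρ 5) = true ∨
        σ.cell (bad d e) (ρ 7) (ρ 5) = true then X.sem (n + 1) inp d' ρ σ else σ := by
    intro e X
    simp only [ifBlocked, Cmd.sem, hρ]
    split_ifs <;> simp_all
  rw [resolve, h, h, h]
  simp only [Blocked, Fin.forall_fin_succ, Fin.isValue, Fin.succ_zero_eq_one, Fin.succ_one_eq_two,
    Cmd.sem, IsEmpty.forall_iff, and_true]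
  split_ifs <;> simp_all

theorem sem_eliminate_avoids {d : ℕ} (hd : d = 6) {ρ : ℕ → ℕ} (hρ : ρ 0 = n) (hρ5 : ρ 5 ≤ n)
    {σ : Store} {f : ℕ → Fin 3} (hf : f n = 2) (h : Avoids n f σ) :
    Avoids n f (eliminate.sem (n + 1) inp d ρ σ) := by
  subst hd
  refine iter_keep (Avoids n f) h fun u hu y hy => iter_keep (Avoids n f) hy fun v hv y hy =>
    Cmd.sem_block_keep (Avoids n f) ?_ _ hy
  intro c' hc' y hy
  obtain ⟨⟨c, d⟩, -, rfl⟩ := List.mem_map.1 hc'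
  rw [sem_resolve (by simpa using hρ)]
  split
  · next hb =>
    refine hy.set fun hcd => ?_
    simp at hb hcd
    rcases hb (f (ρ 5)) with h1 | h1 | h1
    · rw [← hf, hy n le_rfl _ hρ5] at h1; simp at h1
    · rw [← hcd.1, hy u (by omega) _ hρ5] at h1; simp at h1
    · rw [← hcd.2, hy v (by omega) _ hρ5] at h1; simp at h1
  · exact hy

theorem sem_eliminate_cell {d' : ℕ} (hd : d' = 6) {ρ : ℕ → ℕ} (hρ : ρ 0 = n) {σ : Store} {u v : ℕ}
    (hu : u ≤ n) (hv : v ≤ n) {c d : Fin 3} (hb : Blocked n σ (ρ 5) u v c d) :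
    (eliminate.sem (n + 1) inp d' ρ σ).cell (bad c d) u v = true := by
  subst hd
  let P : Store → Prop := fun y => σ.Below y
  have hr : (Cmd.block (labelPairs.map fun x => resolve x.1 x.2)).raises = true := by
    decide +kernel
  have hr1 : (Cmd.all (.block (labelPairs.map fun x => resolve x.1 x.2))).raises = true := hr
  rw [eliminate]
  refine Cmd.sem_all_sets hr1 P (Nat.lt_succ_of_le hu) (.refl _)
    (fun _ y hy => hy.trans (Cmd.below_sem _ _ _ _ hr1)) fun y hy =>
    Cmd.sem_all_sets hr P (Nat.lt_succ_of_le hv) hy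
    (fun _ y hy => hy.trans (Cmd.below_sem _ _ _ _ hr)) fun y hy => ?_
  have hr' : ∀ x : Fin 3 × Fin 3, (resolve x.1 x.2).raises = true := by decide +kernel
  refine Cmd.sem_block_reach P (fun y => y.cell (bad c d) u v = true)
    (List.mem_map.2 ⟨(c, d), mem_labelPairs _, rfl⟩) ?_ ?_ ?_ _ hy
  · intro c' hc' y hy
    obtain ⟨x, -, rfl⟩ := List.mem_map.1 hc'
    exact hy.trans (Cmd.below_sem _ _ _ _ (hr' x))
  · intro y hy
    rw [sem_resolve (by simpa using hρ), if_pos]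
    · simp [Store.set]
    · simpa [Function.update_apply] using hb.mono hy
  · intro c' hc' y hy
    obtain ⟨x, -, rfl⟩ := List.mem_map.1 hc'
    exact Cmd.below_sem _ _ _ _ (hr' x) _ _ _ hy

/-- The store after `j` rounds of elimination. -/
def eliminated (n : ℕ) (inp ρ : ℕ → ℕ) (σ : Store) (j : ℕ) : Store :=
  iter (fun j => eliminate.sem (n + 1) inp 6 (Function.update ρ 5 j)) j σ

theorem eliminated_succ {ρ : ℕ → ℕ} {σ : Store} {j : ℕ} : eliminated n inp ρ σ (j + 1) =
    eliminate.sem (n + 1) inp 6 (Function.update ρ 5 j) (eliminated n inp ρ σ j) := by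
  simp only [eliminated, iter]

theorem below_eliminated {ρ : ℕ → ℕ} {σ : Store} {i j : ℕ} (hij : i ≤ j) :
    (eliminated n inp ρ σ i).Below (eliminated n inp ρ σ j) := by
  induction j, hij using Nat.le_induction with
  | base => exact .refl _
  | succ j _ ih => exact ih.trans (Cmd.below_sem _ _ _ _ raises_eliminate)

theorem eliminated_cell {ρ : ℕ → ℕ} (hρ : ρ 0 = n) {σ : Store} {w j u v : ℕ} (hwj : w < j)
    (hu : u ≤ n) (hv : v ≤ n) {c d : Fin 3}
    (hb : Blocked n (eliminated n inp ρ σ w) w u v c d) :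
    (eliminated n inp ρ σ j).cell (bad c d) u v = true := by
  refine below_eliminated (i := w + 1) hwj _ _ _ ?_
  have hb' : Blocked n (eliminated n inp ρ σ w) (Function.update ρ 5 w 5) u v c d := by
    rwa [Function.update_self]
  rw [eliminated_succ]
  exact sem_eliminate_cell rfl ((Function.update_of_ne (by norm_num) _ _).trans hρ) hu hv hb'

theorem eliminated_avoids {ρ : ℕ → ℕ} (hρ : ρ 0 = n) {σ : Store} {f : ℕ → Fin 3} (hf : f n = 2)
    (h : Avoids n f σ) : Avoids n f (eliminated n inp ρ σ (n + 1)) :=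
  iter_keep (Avoids n f) h fun j hj y hy =>
    sem_eliminate_avoids rfl (by simpa using hρ) (by simp; omega) hf hy

/-- Suppose that two vertices of a triangle each lack one of the labels `0` and `1`. Eliminating these
two vertices takes away a label from the third one as well. -/
theorem exists_excluded_of_triangle {ρ : ℕ → ℕ} (hρ : ρ 0 = n) {σ : Store} {x y v : ℕ} (hxy : x < y)
    (hy : y < n) (hv : v < n)
    (hedge : ∀ c d, clash c d = true → σ.cell (bad c d) y x = true ∧ σ.cell (bad c d) v x = true ∧
      σ.cell (bad c d) v y = true)
    {p q : Fin 3} (hp2 : p ≠ 2) (hq2 : q ≠ 2) (hp : σ.cell (bad 2 p) n x = true)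
    (hq : σ.cell (bad 2 q) n y = true) :
    ∃ c, (eliminated n inp ρ σ (n + 1)).cell (bad 2 c) n v = true := by
  have key : ∀ p q : Fin 3, p ≠ 2 → q ≠ 2 → ∃ c : Fin 3, ∀ e : Fin 3, e = q ∨ clash c e = true ∨
      ∀ e' : Fin 3, e' = p ∨ clash c e' = true ∨ clash e e' = true := by
    intro p q hp hq
    refine ⟨if p = q then p else 2, ?_⟩
    revert p q
    decide
  obtain ⟨c, hc⟩ := key p q hp2 hq2
  have h0 : ∀ j, σ.Below (eliminated n inp ρ σ j) := fun j => below_eliminated (Nat.zero_le j)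
  refine ⟨c, eliminated_cell hρ (w := y) (by omega) le_rfl hv.le fun e => ?_⟩
  rcases hc e with rfl | h | h
  · exact Or.inl (h0 _ _ _ _ hq)
  · exact Or.inr (Or.inr (h0 _ _ _ _ (hedge _ _ h).2.2))
  · refine Or.inr (Or.inr (eliminated_cell hρ hxy hv.le hy.le fun e' => ?_))
    rcases h e' with rfl | h | h
    · exact Or.inl (h0 _ _ _ _ hp)
    · exact Or.inr (Or.inl (h0 _ _ _ _ (hedge _ _ h).2.1))
    · exact Or.inr (Or.inr (h0 _ _ _ _ (hedge _ _ h).1))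

/-- If every vertex lacks a label, then a labelling that is compatible after a round of elimination can
be extended to the vertex that the round eliminates, because pairwise intersecting subsets of a set
with two elements have a common element. -/
theorem exists_extension {ρ : ℕ → ℕ} (hρ : ρ 0 = n) {σ : Store}
    (hex : ∀ v < n, ∃ c, σ.cell (bad 2 c) n v = true)
    (hroot : (eliminated n inp ρ σ (n + 1)).cell (bad 2 2) n n = false) :
    ∃ f : ℕ → Fin 3, f n = 2 ∧ ∀ u ≤ n, ∀ v < u, σ.cell (bad (f u) (f v)) u v = false := by
  have main : ∀ k ≤ n, ∃ f : ℕ → Fin 3, f n = 2 ∧ ∀ u ≤ n, ∀ v < u, n - k ≤ v →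
      (eliminated n inp ρ σ (n - k)).cell (bad (f u) (f v)) u v = false := by
    intro k
    induction k with
    | zero => exact fun _ => ⟨fun _ => 2, rfl, fun u hu v hv hv' => by omega⟩
    | succ k ih =>
      intro hk
      obtain ⟨f, hfn, hf⟩ := ih (by omega)
      set w := n - (k + 1) with hw
      have hw' : n - k = w + 1 := by omega
      rw [hw'] at hf
      set τ := eliminated n inp ρ σ w with hτ
      have hstep : ∀ u ≤ n, ∀ v ≤ n, Blocked n τ w u v (f u) (f v) →
          (eliminated n inp ρ σ (w + 1)).cell (bad (f u) (f v)) u v = true :=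
        fun u hu v hv hb => eliminated_cell hρ (by omega) hu hv hb
      -- two later vertices leave a common label for `w`
      have hpair : ∀ u ≤ n, w < u → ∀ v ≤ n, w < v → ¬ Blocked n τ w u v (f u) (f v) := by
        intro u hu hwu v hv hwv hb
        rcases lt_trichotomy u v with h | rfl | h
        · have := hstep v hv u hu fun e => (hb e).imp_right Or.symm
          rw [hf v hv u h (by omega)] at this
          simp at this
        · rcases hu.lt_or_eq with h | rfl
          · have hb' : Blocked n τ w n u (f n) (f u) := fun e => by
              rcases hb e with h | h | h
              · exact Or.inl h
              · exact Or.inr (Or.inr h)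
              · exact Or.inr (Or.inr h)
            have := hstep n le_rfl u hu hb'
            rw [hf n le_rfl u h (by omega)] at this
            simp at this
          · have := below_eliminated (j := u + 1) (by omega) _ _ _ (hstep u hu u hv hb)
            rw [hfn, hroot] at this
            simp at this
        · have := hstep u hu v hv hb
          rw [hf u hu v h (by omega)] at this
          simp at this
      have hlabel : ∃ e : Fin 3, ∀ u ≤ n, w < u → τ.cell (bad (f u) e) u w = false := by
        by_contra hcon
        push Not at hcon
        choose g hg1 hg2 hg3 using hcon
        obtain ⟨c, hc⟩ := hex w (by omega)
        have hc' : τ.cell (bad 2 c) n w = true := below_eliminated (Nat.zero_le w) _ _ _ hc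
        have key : ∀ c : Fin 3, ∃ e e' : Fin 3, ∀ x, x = c ∨ x = e ∨ x = e' := by decide
        obtain ⟨e, e', he⟩ := key c
        refine hpair (g e) (hg1 e) (hg2 e) (g e') (hg1 e') (hg2 e') fun x => ?_
        rcases he x with rfl | rfl | rfl
        · exact Or.inl hc'
        · exact Or.inr (Or.inl (by simpa using hg3 x))
        · exact Or.inr (Or.inr (by simpa using hg3 x))
      obtain ⟨e, he⟩ := hlabel
      refine ⟨Function.update f w e, by rw [Function.update_of_ne (by omega), hfn], ?_⟩
      intro u hu v hv hwv
      rw [Function.update_of_ne (show u ≠ w by omega)]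
      by_cases hvw : v = w
      · subst hvw
        rw [Function.update_self]
        exact he u hu hv
      · rw [Function.update_of_ne hvw]
        by_contra hc
        have := below_eliminated (j := w + 1) (by omega) _ _ _ (Bool.eq_true_of_not_eq_false hc)
        rw [hf u hu v hv (by omega)] at this
        simp at this
  obtain ⟨f, hfn, hf⟩ := main n le_rfl
  rw [Nat.sub_self] at hf
  exact ⟨f, hfn, fun u hu v hv => hf u hu v hv (Nat.zero_le v)⟩

theorem sem_trial_of_admissible {ρ : ℕ → ℕ} (hρ : ρ 0 = n) (hρ2 : ρ 2 = 0) {σ : Store}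
    {f : ℕ → Fin 3} (hf : Admissible n σ (ρ 3) (ρ 4) f) :
    (trial.sem (n + 1) inp 5 ρ σ).cell 4 0 0 = true := by
  have h := eliminated_avoids (inp := inp) hρ hf.root (eliminated_avoids (inp := inp) hρ hf.root
    (sem_setup_avoids (inp := inp) hρ hf)) n le_rfl n le_rfl
  rw [hf.root] at h
  simp only [eliminated] at h
  simp only [trial, Cmd.sem, hρ, hρ2]
  simp [h, Store.set]

/-- A vertex lies in one of the vertex sets. -/
def Store.Covered (n : ℕ) (σ : Store) (v : ℕ) : Prop := ∃ i ≤ n, σ.cell 1 i v = true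

/-- Every vertex lies in a vertex set, or in a triangle whose other two vertices do. -/
def Store.QuasiCovered (n : ℕ) (σ : Store) : Prop :=
  ∀ v < n, σ.Covered n v ∨ ∃ x y, x < y ∧ y < n ∧ σ.Covered n x ∧ σ.Covered n y ∧
    σ.cell 0 y x = true ∧ σ.cell 0 v x = true ∧ σ.cell 0 v y = true

/-- Matrix `0` is the adjacency matrix of a graph. -/
structure Store.IsGraph (σ : Store) : Prop where
  symm : ∀ u v, σ.cell 0 u v = true → σ.cell 0 v u = true
  irrefl : ∀ v, σ.cell 0 v v = false

/-- A labelling without clashes that uses both sides. -/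
def Store.HasLabelling (n : ℕ) (σ : Store) : Prop :=
  ∃ (f : ℕ → Fin 3) (a b : ℕ), a < n ∧ b < n ∧ f a = 0 ∧ f b = 1 ∧
    ∀ u ≤ n, ∀ v ≤ n, σ.cell 0 u v = true → clash (f u) (f v) = false

theorem hasLabelling_of_sem_trial {ρ : ℕ → ℕ} (hρ : ρ 0 = n) (hρ2 : ρ 2 = 0) (hρ3 : ρ 3 ≤ n)
    (hρ4 : ρ 4 ≤ n) {σ : Store} (hG : σ.IsGraph) (hq : σ.QuasiCovered n)
    (h : (trial.sem (n + 1) inp 5 ρ σ).cell 4 0 0 = true) :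
    σ.cell 4 0 0 = true ∨ σ.HasLabelling n := by
  set σ₀ := setup.sem (n + 1) inp 5 ρ σ with hσ₀
  set σ₁ := eliminated n inp ρ σ₀ (n + 1) with hσ₁
  set σ₂ := eliminated n inp ρ σ₁ (n + 1) with hσ₂
  have hsem : trial.sem (n + 1) inp 5 ρ σ =
      if σ₂.cell (bad 2 2) n n = true then σ₂ else σ₂.set 4 0 0 true := by
    simp only [trial, Cmd.sem, hρ, hρ2]
    rfl
  have hans : σ₂.cell 4 = σ.cell 4 := by
    have h1 : ∀ τ : Store, (eliminated n inp ρ τ (n + 1)).cell 4 = τ.cell 4 := fun τ =>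
      Cmd.sem_cell_of_not_writes (.all eliminate) 5 ρ τ (by decide +kernel)
    rw [hσ₂, h1, hσ₁, h1, hσ₀, Cmd.sem_cell_of_not_writes setup _ _ _ (by decide +kernel)]
  rw [hsem] at h
  split at h
  · left
    rw [← hans]
    exact h
  next hroot =>
  right
  have hroot' : σ₂.cell (bad 2 2) n n = false := by simpa using hroot
  have h01 : σ₀.Below σ₁ := below_eliminated (Nat.zero_le _)
  have h12 : σ₁.Below σ₂ := below_eliminated (Nat.zero_le _)
  obtain ⟨f, hfn, hf⟩ := exists_extension hρ (σ := σ₁) (fun v hv => by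
    rcases hq v hv with ⟨i, hi, hiv⟩ | ⟨x, y, hxy, hy, ⟨i, hi, hix⟩, ⟨j, hj, hjy⟩, h1, h2, h3⟩
    · obtain ⟨c, -, hc⟩ := sem_setup_side (inp := inp) hρ hi hv.le hiv
      exact ⟨c, h01 _ _ _ hc⟩
    · obtain ⟨p, hp2, hp⟩ := sem_setup_side (inp := inp) hρ hi (by omega) hix
      obtain ⟨q, hq2, hq⟩ := sem_setup_side (inp := inp) hρ hj (by omega) hjy
      exact exists_excluded_of_triangle hρ hxy hy hv (fun c d hcd =>
        ⟨sem_setup_edge (by omega) (by omega) h1 hcd, sem_setup_edge (by omega) (by omega) h2 hcd,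
          sem_setup_edge (by omega) (by omega) h3 hcd⟩) hp2 hq2 hp hq) hroot'
  have hends := sem_noteEnds_cell (inp := inp) hρ
    (σ := noteSides.sem (n + 1) inp 5 ρ (noteEdges.sem (n + 1) inp 5 ρ
      (clearBad.sem (n + 1) inp 5 ρ σ)))
  -- a vertex at which all labels but one are excluded is not the extra vertex, and has that label
  have hend : ∀ v ≤ n, ∀ e : Fin 3, e ≠ 2 → (∀ c : Fin 3, c ≠ e → σ₀.cell (bad 2 c) n v = true) →
      v < n ∧ f v = e := by
    intro v hv e he2 he
    have hvn : v < n := by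
      refine lt_of_le_of_ne hv ?_
      rintro rfl
      have := h12 _ _ _ (h01 _ _ _ (he 2 he2.symm))
      rw [hroot'] at this
      simp at this
    refine ⟨hvn, ?_⟩
    by_contra hc
    have := h01 _ _ _ (he _ hc)
    have h2 := hf n le_rfl v hvn
    rw [hfn, this] at h2
    simp at h2
  obtain ⟨ha, hfa⟩ := hend _ hρ3 0 (by decide) hends.1
  obtain ⟨hb, hfb⟩ := hend _ hρ4 1 (by decide) hends.2
  have hlt : ∀ u ≤ n, ∀ v < u, σ.cell 0 u v = true → clash (f u) (f v) = false := by
    intro u hu v hv huv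
    by_contra hc
    have := h01 _ _ _ (sem_setup_edge (inp := inp) (ρ := ρ) hu (by omega) huv
      (Bool.eq_true_of_not_eq_false hc))
    rw [hf u hu v hv] at this
    simp at this
  refine ⟨f, _, _, ha, hb, hfa, hfb, fun u hu v hv huv => ?_⟩
  have hsymm : ∀ c d, clash c d = clash d c := by decide
  rcases lt_trichotomy u v with h | rfl | h
  · rw [hsymm]
    exact hlt v hv u h (hG.symm _ _ huv)
  · rw [hG.irrefl] at huv
    simp at huv
  · exact hlt u hu v h huv

end

/-! ### Running through all choices of sides -/

theorem testBit_succ_eq_xor (j i : ℕ) :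
    (j + 1).testBit i = ((j.testBit i) ^^ decide (2 ^ i ∣ j + 1)) := by
  obtain ⟨a, r, hr, rfl⟩ : ∃ a r, r < 2 ^ i ∧ j = 2 ^ i * a + r :=
    ⟨j / 2 ^ i, j % 2 ^ i, Nat.mod_lt _ (by positivity), (Nat.div_add_mod _ _).symm⟩
  have h1 : (2 ^ i * a + r) / 2 ^ i = a := by
    rw [Nat.mul_add_div (by positivity), Nat.div_eq_of_lt hr, Nat.add_zero]
  rw [Nat.testBit_eq_decide_div_mod_eq, Nat.testBit_eq_decide_div_mod_eq, h1]
  by_cases h : r + 1 = 2 ^ i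
  · have h2 : 2 ^ i * a + r + 1 = 2 ^ i * (a + 1) := by rw [Nat.add_assoc, h]; ring
    rw [h2, Nat.mul_div_cancel_left _ (by positivity)]
    rcases Nat.mod_two_eq_zero_or_one a with h3 | h3 <;> simp [Nat.add_mod, h3]
  · have h2 : (2 ^ i * a + r + 1) / 2 ^ i = a := by
      rw [Nat.add_assoc, Nat.mul_add_div (by positivity), Nat.div_eq_of_lt (by omega), Nat.add_zero]
    have h3 : ¬ 2 ^ i ∣ 2 ^ i * a + r + 1 := by
      rw [Nat.add_assoc, Nat.dvd_add_right (Dvd.intro _ rfl)]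
      exact Nat.not_dvd_of_pos_of_lt (by omega) (by omega)
    rw [h2]
    simp [h3]

theorem two_pow_succ_dvd_succ_iff (j i : ℕ) :
    2 ^ (i + 1) ∣ j + 1 ↔ 2 ^ i ∣ j + 1 ∧ j.testBit i = true := by
  obtain ⟨a, r, hr, rfl⟩ : ∃ a r, r < 2 ^ i ∧ j = 2 ^ i * a + r :=
    ⟨j / 2 ^ i, j % 2 ^ i, Nat.mod_lt _ (by positivity), (Nat.div_add_mod _ _).symm⟩
  have h1 : (2 ^ i * a + r) / 2 ^ i = a := by
    rw [Nat.mul_add_div (by positivity), Nat.div_eq_of_lt hr, Nat.add_zero]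
  rw [Nat.testBit_eq_decide_div_mod_eq, h1, decide_eq_true_eq]
  by_cases h : r + 1 = 2 ^ i
  · have h2 : 2 ^ i * a + r + 1 = 2 ^ i * (a + 1) := by rw [Nat.add_assoc, h]; ring
    rw [h2, pow_succ, Nat.mul_dvd_mul_iff_left (by positivity)]
    have h3 : 2 ^ i ∣ 2 ^ i * (a + 1) := Dvd.intro _ rfl
    simp only [h3, true_and]
    omega
  · have h3 : ¬ 2 ^ i ∣ 2 ^ i * a + r + 1 := by
      rw [Nat.add_assoc, Nat.dvd_add_right (Dvd.intro _ rfl)]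
      exact Nat.not_dvd_of_pos_of_lt (by omega) (by omega)
    exact ⟨fun h => absurd ((pow_dvd_pow 2 (Nat.le_succ i)).trans h) h3, fun h => absurd h.1 h3⟩

section

variable {n : ℕ} {inp : ℕ → ℕ}

theorem sem_increment {ρ : ℕ → ℕ} (hρ : ρ 0 = n) {σ : Store} {j : ℕ}
    (h : ∀ i ≤ n, σ.cell 3 n i = j.testBit i) :
    ∀ i ≤ n, (increment.sem (n + 1) inp 3 ρ σ).cell 3 n i = (j + 1).testBit i := by
  let I : ℕ → Store → Prop := fun t y => y.cell 5 n n = decide (2 ^ t ∣ j + 1) ∧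
    ∀ i ≤ n, y.cell 3 n i = if i < t then (j + 1).testBit i else j.testBit i
  have key : I (n + 1) (increment.sem (n + 1) inp 3 ρ σ) := by
    refine iter_inv I ⟨?_, ?_⟩ ?_
    · simp [Cmd.sem, Store.set, hρ]
    · intro i hi
      simpa [Cmd.sem, Store.set, hρ] using h i hi
    rintro t ht y ⟨hc, hb⟩
    have ht' := hb t (by omega)
    rw [if_neg (lt_irrefl t)] at ht'
    have hx := testBit_succ_eq_xor j t
    have hd := two_pow_succ_dvd_succ_iff j t
    simp only [Cmd.sem, Function.update_apply]
    simp only [reduceIte, OfNat.zero_ne_ofNat, hρ, hc, ht']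
    by_cases hdvd : 2 ^ t ∣ j + 1
    · by_cases hbit : j.testBit t = true
      · simp only [hdvd, hbit, decide_true, if_true]
        refine ⟨by simp [Store.set, hc, hdvd, hd, hbit], fun i hi => ?_⟩
        rcases lt_trichotomy i t with hit | rfl | hit
        · simp [Store.set, hit.ne, hb i hi, hit, hit.trans (Nat.lt_succ_self t)]
        · simp [Store.set, hx, hbit, hdvd]
        · simp [Store.set, hit.ne', hb i hi, not_lt.2 hit.le, not_lt.2 (Nat.succ_le_of_lt hit)]
      · simp only [hdvd, hbit, decide_true, if_true]
        refine ⟨by simp [Store.set, hd, hbit], fun i hi => ?_⟩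
        rcases lt_trichotomy i t with hit | rfl | hit
        · simp [Store.set, hit.ne, hb i hi, hit, hit.trans (Nat.lt_succ_self t)]
        · simp [Store.set, hx, hbit, hdvd]
        · simp [Store.set, hit.ne', hb i hi, not_lt.2 hit.le, not_lt.2 (Nat.succ_le_of_lt hit)]
    · simp only [hdvd, decide_false]
      refine ⟨by simp [hc, hdvd, hd], fun i hi => ?_⟩
      rcases lt_trichotomy i t with hit | rfl | hit
      · simp [hb i hi, hit, hit.trans (Nat.lt_succ_self t)]
      · simp [ht', hx, hdvd]
      · simp [hb i hi, not_lt.2 hit.le, not_lt.2 (Nat.succ_le_of_lt hit)]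
  intro i hi
  rw [key.2 i hi, if_pos (by omega)]

theorem sem_trial_of_answer {ρ : ℕ → ℕ} {d : ℕ} {σ : Store} (h : σ.cell 4 0 0 = true) :
    (trial.sem (n + 1) inp d ρ σ).cell 4 0 0 = true := by
  have hfinal : (Cmd.ifCell (bad 2 2) 0 0 .skip (.set 4 2 2 true)).raises = true := by decide
  refine Cmd.below_sem _ d ρ _ hfinal _ _ _ ?_
  rw [Cmd.sem_cell_of_not_writes (.all eliminate) _ _ _ (by decide +kernel),
    Cmd.sem_cell_of_not_writes (.all eliminate) _ _ _ (by decide +kernel),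
    Cmd.sem_cell_of_not_writes setup _ _ _ (by decide +kernel)]
  exact h

/-- The matrices `0`, `1` and `3` agree. -/
def SameInstance (σ τ : Store) : Prop :=
  τ.cell 0 = σ.cell 0 ∧ τ.cell 1 = σ.cell 1 ∧ τ.cell 3 = σ.cell 3

theorem sem_trial_sameInstance {ρ : ℕ → ℕ} {d : ℕ} {σ τ : Store} (h : SameInstance σ τ) :
    SameInstance σ (trial.sem (n + 1) inp d ρ τ) :=
  ⟨(Cmd.sem_cell_of_not_writes trial _ _ _ (by decide +kernel)).trans h.1,
    (Cmd.sem_cell_of_not_writes trial _ _ _ (by decide +kernel)).trans h.2.1,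
    (Cmd.sem_cell_of_not_writes trial _ _ _ (by decide +kernel)).trans h.2.2⟩

theorem sem_trials_sameInstance {ρ : ℕ → ℕ} {d : ℕ} {σ τ : Store} (h : SameInstance σ τ) :
    SameInstance σ ((Cmd.all trial).sem (n + 1) inp d ρ τ) :=
  iter_keep (SameInstance σ) h fun _ _ _ hy => sem_trial_sameInstance hy

theorem Admissible.of_sameInstance {σ τ : Store} (h : SameInstance σ τ) {a b : ℕ} {f : ℕ → Fin 3}
    (hf : Admissible n σ a b f) : Admissible n τ a b f where
  root := hf.root
  left := hf.left
  right := hf.right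
  edge := by rw [h.1]; exact hf.edge
  side := by rw [h.2.1, h.2.2]; exact hf.side

theorem sem_trials_of_answer {ρ : ℕ → ℕ} {d : ℕ} {σ : Store} (h : σ.cell 4 0 0 = true) :
    ((Cmd.all trial).sem (n + 1) inp d ρ σ).cell 4 0 0 = true :=
  iter_keep (α := Store) (fun y => y.cell 4 0 0 = true) h fun _ _ _ hy => sem_trial_of_answer hy

theorem sem_round_cell {ρ : ℕ → ℕ} {σ : Store} :
    (round.sem (n + 1) inp 3 ρ σ).cell 0 = σ.cell 0 ∧
      (round.sem (n + 1) inp 3 ρ σ).cell 1 = σ.cell 1 :=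
  ⟨Cmd.sem_cell_of_not_writes round _ _ _ (by decide +kernel),
    Cmd.sem_cell_of_not_writes round _ _ _ (by decide +kernel)⟩

theorem sem_round_side {ρ : ℕ → ℕ} (hρ : ρ 0 = n) {σ : Store} {j : ℕ}
    (h : ∀ i ≤ n, σ.cell 3 n i = j.testBit i) :
    ∀ i ≤ n, (round.sem (n + 1) inp 3 ρ σ).cell 3 n i = (j + 1).testBit i := by
  refine sem_increment hρ ?_
  rw [Cmd.sem_cell_of_not_writes (.all (.all trial)) _ _ _ (by decide +kernel)]
  exact h

theorem sem_round_answer {ρ : ℕ → ℕ} {σ : Store} : (round.sem (n + 1) inp 3 ρ σ).cell 4 =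
    ((Cmd.all (.all trial)).sem (n + 1) inp 3 ρ σ).cell 4 :=
  Cmd.sem_cell_of_not_writes increment _ _ _ (by decide)

theorem sem_round_of_answer {ρ : ℕ → ℕ} {σ : Store} (h : σ.cell 4 0 0 = true) :
    (round.sem (n + 1) inp 3 ρ σ).cell 4 0 0 = true := by
  rw [sem_round_answer]
  exact iter_keep (α := Store) (fun y => y.cell 4 0 0 = true) h fun _ _ _ hy => sem_trials_of_answer hy

theorem sem_round_of_admissible {ρ : ℕ → ℕ} (hρ : ρ 0 = n) (hρ2 : ρ 2 = 0) {σ : Store} {a b : ℕ}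
    (ha : a ≤ n) (hb : b ≤ n) {f : ℕ → Fin 3} (hf : Admissible n σ a b f) :
    (round.sem (n + 1) inp 3 ρ σ).cell 4 0 0 = true := by
  rw [sem_round_answer]
  refine iter_reach (SameInstance σ) (fun y => y.cell 4 0 0 = true) (Nat.lt_succ_of_le ha)
    ⟨rfl, rfl, rfl⟩ (fun _ _ _ hy => sem_trials_sameInstance hy) (fun y hy => ?_)
    fun _ _ _ hy => sem_trials_of_answer hy
  refine iter_reach (SameInstance σ) (fun y => y.cell 4 0 0 = true) (Nat.lt_succ_of_le hb)
    hy (fun _ _ _ hy => sem_trial_sameInstance hy) (fun y hy => ?_)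
    fun _ _ _ hy => sem_trial_of_answer hy
  exact sem_trial_of_admissible (by simpa using hρ) (by simpa using hρ2)
    (by simpa using hf.of_sameInstance hy)

theorem Store.IsGraph.of_eq {σ τ : Store} (h : τ.cell 0 = σ.cell 0) (hσ : σ.IsGraph) :
    τ.IsGraph :=
  ⟨by rw [h]; exact hσ.symm, by rw [h]; exact hσ.irrefl⟩

theorem Store.QuasiCovered.of_eq {σ τ : Store} (h : τ.cell 0 = σ.cell 0)
    (h' : τ.cell 1 = σ.cell 1) (hσ : σ.QuasiCovered n) : τ.QuasiCovered n := by
  simpa only [QuasiCovered, Covered, h, h'] using hσ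

theorem Store.HasLabelling.of_eq {σ τ : Store} (h : τ.cell 0 = σ.cell 0) (hσ : σ.HasLabelling n) :
    τ.HasLabelling n := by
  simpa only [HasLabelling, h] using hσ

theorem hasLabelling_of_sem_round {ρ : ℕ → ℕ} (hρ : ρ 0 = n) (hρ2 : ρ 2 = 0) {σ : Store}
    (hG : σ.IsGraph) (hq : σ.QuasiCovered n)
    (h : (round.sem (n + 1) inp 3 ρ σ).cell 4 0 0 = true) :
    σ.cell 4 0 0 = true ∨ σ.HasLabelling n := by
  rw [sem_round_answer] at h
  let I : Store → Prop := fun y => SameInstance σ y ∧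
    (y.cell 4 0 0 = true → σ.cell 4 0 0 = true ∨ σ.HasLabelling n)
  refine (iter_keep I ⟨⟨rfl, rfl, rfl⟩, Or.inl⟩ fun a ha y hy =>
    iter_keep I hy fun b hb y hy => ⟨sem_trial_sameInstance hy.1, fun h => ?_⟩).2 h
  rcases hasLabelling_of_sem_trial (by simpa using hρ) (by simpa using hρ2)
    (by simp; omega) (by simp; omega) (hG.of_eq hy.1.1) (hq.of_eq hy.1.1 hy.1.2.1) h with h | h
  · exact hy.2 h
  · exact Or.inr (h.of_eq hy.1.1.symm)

/-- Only labellings make the answer `true`. -/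
theorem hasLabelling_of_rounds {ρ : ℕ → ℕ} (hρ : ρ 0 = n) (hρ2 : ρ 2 = 0) {σ : Store}
    (hG : σ.IsGraph) (hq : σ.QuasiCovered n) (h4 : σ.cell 4 0 0 = false) {N : ℕ}
    (h : (iter (fun _ => round.sem (n + 1) inp 3 ρ) N σ).cell 4 0 0 = true) :
    σ.HasLabelling n := by
  let I : Store → Prop := fun y => y.cell 0 = σ.cell 0 ∧ y.cell 1 = σ.cell 1 ∧
    (y.cell 4 0 0 = true → σ.HasLabelling n)
  refine (iter_keep I ⟨rfl, rfl, by simp [h4]⟩ fun _ _ y hy =>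
    ⟨sem_round_cell.1.trans hy.1, sem_round_cell.2.trans hy.2.1, fun h => ?_⟩).2.2 h
  rcases hasLabelling_of_sem_round hρ hρ2 (hG.of_eq hy.1) (hq.of_eq hy.1 hy.2.1) h with h | h
  · exact hy.2.2 h
  · exact h.of_eq hy.1.symm

/-- A labelling in which no vertex set meets both sides makes the answer `true`. -/
theorem rounds_of_labelling {ρ : ℕ → ℕ} (hρ : ρ 0 = n) (hρ2 : ρ 2 = 0) {σ : Store}
    (h3 : ∀ i ≤ n, σ.cell 3 n i = false) {k : ℕ} {f : ℕ → Fin 3} {a b : ℕ} (ha : a ≤ n) (hb : b ≤ n)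
    (hfn : f n = 2) (hfa : f a = 0) (hfb : f b = 1)
    (hedge : ∀ u ≤ n, ∀ v ≤ n, σ.cell 0 u v = true → clash (f u) (f v) = false) (s : ℕ → Bool)
    (hs : ∀ i ≤ n, ∀ v ≤ n, σ.cell 1 i v = true → i < k ∧ f v ≠ if s i then 0 else 1) :
    (iter (fun _ => round.sem (n + 1) inp 3 ρ) (2 ^ k) σ).cell 4 0 0 = true := by
  set j₀ := Nat.ofBits fun i : Fin k => s i with hj₀
  let I : ℕ → Store → Prop := fun j y => y.cell 0 = σ.cell 0 ∧ y.cell 1 = σ.cell 1 ∧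
    (∀ i ≤ n, y.cell 3 n i = j.testBit i) ∧ (j₀ < j → y.cell 4 0 0 = true)
  refine (iter_inv I ⟨rfl, rfl, by simpa using h3, by simp⟩ ?_).2.2.2
    (Nat.ofBits_lt_two_pow _)
  rintro j _ y ⟨hy0, hy1, hy3, hy4⟩
  refine ⟨sem_round_cell.1.trans hy0, sem_round_cell.2.trans hy1, sem_round_side hρ hy3,
    fun hj => ?_⟩
  rcases Nat.lt_succ_iff_lt_or_eq.1 hj with h | rfl
  · exact sem_round_of_answer (hy4 h)
  · refine sem_round_of_admissible hρ hρ2 ha hb (f := f)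
      ⟨hfn, hfa, hfb, by rw [hy0]; exact hedge, fun i hi v hv hiv => ?_⟩
    rw [hy1] at hiv
    obtain ⟨hik, hne⟩ := hs i hi v hv hiv
    rw [hy3 i hi, hj₀, Nat.testBit_ofBits_lt _ _ hik]
    exact hne

/-! ### Reading the input -/

theorem sem_readRow {A p d : ℕ} (hp : p < d) {ρ : ℕ → ℕ} (hρ : ρ 0 = n) {σ : Store} :
    let τ := (readRow A p d).sem (n + 1) inp d ρ σ
    τ.pos = σ.pos + n ∧ ∀ A' i j, τ.cell A' i j =
      if A' = A ∧ i = ρ p ∧ j < n then decide (inp (σ.pos + j) ≠ 0) else σ.cell A' i j := by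
  have h0 : (0 : ℕ) ≠ d := by omega
  let I : ℕ → Store → Prop := fun t y => y.pos = σ.pos + t ∧ ∀ A' i j, y.cell A' i j =
      if A' = A ∧ i = ρ p ∧ j < t then decide (inp (σ.pos + j) ≠ 0) else σ.cell A' i j
  have key := iter_inv (f := fun j => (Cmd.ifLt d 0 (.read A p d) .skip).sem (n + 1) inp (d + 1)
    (Function.update ρ d j)) (n := n) (x := σ) I ⟨rfl, by simp⟩ (by
      rintro t ht y ⟨hpos, hc⟩
      simp only [Cmd.sem, Function.update_self, Function.update_of_ne h0, hρ, ht, if_true,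
        Function.update_of_ne hp.ne]
      refine ⟨by simp [hpos, Nat.add_assoc], fun A' i j => ?_⟩
      simp only [Store.set, hc, hpos]
      by_cases h : A' = A ∧ i = ρ p
      · obtain ⟨rfl, rfl⟩ := h
        rcases lt_trichotomy j t with hj | rfl | hj
        · simp [hj, hj.ne, hj.trans (Nat.lt_succ_self t)]
        · simp
        · simp [hj.ne', not_lt.2 hj.le, not_lt.2 (Nat.succ_le_of_lt hj)]
      · have h1 : ∀ q : Prop, ¬(A' = A ∧ i = ρ p ∧ q) := fun q hq => h ⟨hq.1, hq.2.1⟩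
        simp [h1])
  have hlast : (readRow A p d).sem (n + 1) inp d ρ σ =
      iter (fun j => (Cmd.ifLt d 0 (.read A p d) .skip).sem (n + 1) inp (d + 1)
        (Function.update ρ d j)) n σ := by
    simp only [readRow, Cmd.sem, iter, Function.update_self, Function.update_of_ne h0, hρ,
      lt_irrefl, if_false]
  rw [hlast]
  exact key

theorem sem_readMatrix {A d : ℕ} (hd : 0 < d) {ρ : ℕ → ℕ} (hρ : ρ 0 = n) {σ : Store} :
    let τ := (readMatrix A d).sem (n + 1) inp d ρ σ
    τ.pos = σ.pos + n * n ∧ ∀ A' i j, τ.cell A' i j =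
      if A' = A ∧ i < n ∧ j < n then decide (inp (σ.pos + i * n + j) ≠ 0) else σ.cell A' i j := by
  have h0 : (0 : ℕ) ≠ d := by omega
  let I : ℕ → Store → Prop := fun t y => y.pos = σ.pos + t * n ∧ ∀ A' i j, y.cell A' i j =
      if A' = A ∧ i < t ∧ j < n then decide (inp (σ.pos + i * n + j) ≠ 0) else σ.cell A' i j
  have key := iter_inv (f := fun j => (Cmd.ifLt d 0 (readRow A d (d + 1)) .skip).sem (n + 1) inp
    (d + 1) (Function.update ρ d j)) (n := n) (x := σ) I ⟨by simp, by simp⟩ (by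
      rintro t ht y ⟨hpos, hc⟩
      simp only [Cmd.sem, Function.update_self, Function.update_of_ne h0, hρ, ht, if_true]
      obtain ⟨h1, h2⟩ := sem_readRow (inp := inp) (A := A) (Nat.lt_succ_self d)
        (ρ := Function.update ρ d t) (by rw [Function.update_of_ne h0, hρ]) (σ := y)
      refine ⟨by rw [h1, hpos]; ring, fun A' i j => ?_⟩
      rw [h2, hc, hpos, Function.update_self]
      by_cases h : A' = A ∧ j < n
      · obtain ⟨rfl, hj⟩ := h
        rcases lt_trichotomy i t with hi | rfl | hi
        · simp [hi, hi.ne, hi.trans (Nat.lt_succ_self t)]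
        · simp [hj]
        · simp [hi.ne', not_lt.2 hi.le, not_lt.2 (Nat.succ_le_of_lt hi)]
      · have h1 : ∀ q : Prop, ¬(A' = A ∧ q ∧ j < n) := fun q hq => h ⟨hq.1, hq.2.2⟩
        simp [h1])
  have hlast : (readMatrix A d).sem (n + 1) inp d ρ σ =
      iter (fun j => (Cmd.ifLt d 0 (readRow A d (d + 1)) .skip).sem (n + 1) inp (d + 1)
        (Function.update ρ d j)) n σ := by
    simp only [readMatrix, Cmd.sem, iter, Function.update_self, Function.update_of_ne h0, hρ,
      lt_irrefl, if_false]
  rw [hlast]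
  exact key

theorem sem_decode_graph {k u v : ℕ} :
    (decode.sem (n + 1) inp 3 (baseVars n k) Store.init).cell 0 u v = true ↔
      u < n ∧ v < n ∧ inp (2 + u * n + v) ≠ 0 := by
  have h := (sem_readMatrix (inp := inp) (n := n) (A := 0) (d := 3) (by norm_num)
    (ρ := baseVars n k) rfl (σ := Store.init)).2 0 u v
  rw [decode, Cmd.sem, Cmd.sem_cell_of_not_writes _ _ _ _ (by decide), h]
  by_cases huv : u < n ∧ v < n
  · rw [if_pos ⟨rfl, huv⟩, decide_eq_true_iff]
    exact ⟨fun h => ⟨huv.1, huv.2, h⟩, fun h => h.2.2⟩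
  · rw [if_neg fun h => huv h.2]
    exact ⟨fun h => by simp [Store.init] at h, fun h => absurd ⟨h.1, h.2.1⟩ huv⟩

theorem sem_decode_of_untouched {k A u v : ℕ} (hA : decode.writes A = false) :
    (decode.sem (n + 1) inp 3 (baseVars n k) Store.init).cell A u v = false := by
  rw [Cmd.sem_cell_of_not_writes _ _ _ _ hA]
  rfl

theorem sem_decode_sets {k : ℕ} (hk : k < n) {i v : ℕ} :
    (decode.sem (n + 1) inp 3 (baseVars n k) Store.init).cell 1 i v = true ↔
      i < k ∧ v < n ∧ inp (2 + n * n + i * (n + n * n) + v) ≠ 0 := by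
  obtain ⟨h1, h2⟩ := sem_readMatrix (inp := inp) (n := n) (A := 0) (d := 3) (by norm_num)
    (ρ := baseVars n k) rfl (σ := Store.init)
  set σ := (readMatrix 0 3).sem (n + 1) inp 3 (baseVars n k) Store.init with hσ
  let I : ℕ → Store → Prop := fun t y => y.pos = σ.pos + min t k * (n + n * n) ∧
    ∀ i j, y.cell 1 i j = decide (i < min t k ∧ j < n ∧
      inp (σ.pos + i * (n + n * n) + j) ≠ 0)
  have hk' : baseVars n k 1 < baseVars n k 0 := hk
  have hsem : decode.sem (n + 1) inp 3 (baseVars n k) Store.init =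
      iter (fun j => (Cmd.ifLt 3 1 (.seq (readRow 1 3 4) (readMatrix 2 4)) .skip).sem (n + 1) inp 4
        (Function.update (baseVars n k) 3 j)) (n + 1) σ := by
    simp only [decode, Cmd.sem, hk', if_true]
    rfl
  have key := iter_inv (f := fun j => (Cmd.ifLt 3 1 (.seq (readRow 1 3 4) (readMatrix 2 4))
    .skip).sem (n + 1) inp 4 (Function.update (baseVars n k) 3 j)) (n := n + 1) (x := σ) I
    ⟨by simp, fun i j => by rw [h2]; simp [Store.init]⟩ (by
      rintro t ht y ⟨hpos, hc⟩
      by_cases htk : t < k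
      · have hlt : Function.update (baseVars n k) 3 t 3 < Function.update (baseVars n k) 3 t 1 := by
          simpa [baseVars] using htk
        have hm : min t k = t := by omega
        have hm' : min (t + 1) k = t + 1 := by omega
        rw [hm] at hpos hc
        simp only [Cmd.sem, hlt, if_true]
        obtain ⟨r1, r2⟩ := sem_readRow (inp := inp) (n := n) (A := 1) (p := 3) (d := 4)
          (by norm_num) (ρ := Function.update (baseVars n k) 3 t) (by simp [baseVars]) (σ := y)
        obtain ⟨m1, m2⟩ := sem_readMatrix (inp := inp) (n := n) (A := 2) (d := 4)
          (by norm_num) (ρ := Function.update (baseVars n k) 3 t) (by simp [baseVars])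
          (σ := (readRow 1 3 4).sem (n + 1) inp 4 (Function.update (baseVars n k) 3 t) y)
        refine ⟨by rw [m1, r1, hpos, hm']; ring, fun i j => ?_⟩
        rw [m2, r2, hc, hpos, Function.update_self, hm']
        rcases lt_trichotomy i t with hi | rfl | hi
        · simp [hi.ne, hi, hi.trans (Nat.lt_succ_self t)]
        · by_cases hj : j < n <;> simp [hj]
        · simp [hi.ne', not_lt.2 hi.le, not_lt.2 (Nat.succ_le_of_lt hi)]
      · have hlt : ¬ Function.update (baseVars n k) 3 t 3 <
            Function.update (baseVars n k) 3 t 1 := by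
          simpa [baseVars] using htk
        have hm : min t k = k := by omega
        have hm' : min (t + 1) k = k := by omega
        rw [hm] at hpos hc
        simp only [Cmd.sem, hlt, if_false, I, hm']
        exact ⟨hpos, hc⟩)
  have hm : min (n + 1) k = k := by omega
  have := key.2 i v
  rw [hm] at this
  rw [hsem, this, decide_eq_true_eq, h1]
  rfl

theorem sem_decode_singletons {k : ℕ} (hk : n ≤ k) {i v : ℕ} :
    (decode.sem (n + 1) inp 3 (baseVars n k) Store.init).cell 1 i v = true ↔ i < n ∧ i = v := by
  obtain ⟨-, h2⟩ := sem_readMatrix (inp := inp) (n := n) (A := 0) (d := 3) (by norm_num)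
    (ρ := baseVars n k) rfl (σ := Store.init)
  set σ := (readMatrix 0 3).sem (n + 1) inp 3 (baseVars n k) Store.init with hσ
  let I : ℕ → Store → Prop := fun t y => ∀ i j, y.cell 1 i j = decide (i < t ∧ i < n ∧ i = j)
  have hk' : ¬ baseVars n k 1 < baseVars n k 0 := not_lt.2 hk
  have hsem : decode.sem (n + 1) inp 3 (baseVars n k) Store.init =
      iter (fun j => (Cmd.ifLt 3 0 (.set 1 3 3 true) .skip).sem (n + 1) inp 4
        (Function.update (baseVars n k) 3 j)) (n + 1) σ := by
    simp only [decode, Cmd.sem, hk', if_false]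
    rfl
  have key := iter_inv (f := fun j => (Cmd.ifLt 3 0 (.set 1 3 3 true) .skip).sem (n + 1) inp 4
    (Function.update (baseVars n k) 3 j)) (n := n + 1) (x := σ) I
    (fun i j => by rw [h2]; simp [Store.init]) (by
      intro t ht y hy i j
      replace hy : ∀ i j, y.cell 1 i j = decide (i < t ∧ i < n ∧ i = j) := hy
      have h0 : Function.update (baseVars n k) 3 t 0 = n := by simp [baseVars]
      simp only [Cmd.sem, h0, Function.update_self]
      by_cases hit : i = t
      · subst hit
        by_cases hin : i < n
        · by_cases hij : i = j
          · subst hij; simp [Store.set, hin]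
          · simp [Store.set, hin, hy, hij]; omega
        · simp [hin, hy]
      · have : i < t ↔ i < t + 1 := by omega
        split <;> simp [Store.set, hit, hy, this])
  have := key i v
  rw [hsem, this, decide_eq_true_eq]
  omega

end

/-! ### Looking up the encoding of an instance -/

theorem getD_flatMap {α : Type*} {f : α → List ℕ} {N : ℕ} (hN : ∀ a, (f a).length = N) :
    ∀ (l : List α) (i j : ℕ) (hi : i < l.length), j < N →
      (l.flatMap f).getD (i * N + j) 0 = (f l[i]).getD j 0
  | [], i, _, hi, _ => by simp at hi
  | a :: l, 0, j, _, hj => by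
    rw [List.flatMap_cons, Nat.zero_mul, Nat.zero_add,
      List.getD_append _ _ _ _ (by rw [hN]; exact hj)]
    rfl
  | a :: l, i + 1, j, hi, hj => by
    have he : (i + 1) * N + j - N = i * N + j := by rw [Nat.succ_mul]; omega
    rw [List.flatMap_cons, List.getD_append_right _ _ _ _ (by rw [hN, Nat.succ_mul]; omega), hN, he,
      getD_flatMap hN l i j (by simpa using hi) hj]
    rfl

theorem length_flatMap_of_forall {α : Type*} {f : α → List ℕ} {N : ℕ}
    (hN : ∀ a, (f a).length = N) (l : List α) : (l.flatMap f).length = l.length * N := by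
  simp [List.length_flatMap, hN]

section

variable {n : ℕ}

theorem length_vertexWords (S : Set (Fin n)) : (vertexWords S).length = n := by
  simp [vertexWords]

theorem length_adjWords (R : Fin n → Fin n → Prop) : (adjWords R).length = n * n := by
  rw [adjWords, length_flatMap_of_forall (N := n) (by simp)]
  simp

theorem getD_vertexWords (S : Set (Fin n)) {v : ℕ} (hv : v < n) :
    (vertexWords S).getD v 0 ≠ 0 ↔ (⟨v, hv⟩ : Fin n) ∈ S := by
  simp [vertexWords, List.getD_eq_getElem?_getD, hv]

theorem getD_adjWords (R : Fin n → Fin n → Prop) {u v : ℕ} (hu : u < n) (hv : v < n) :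
    (adjWords R).getD (u * n + v) 0 ≠ 0 ↔ R ⟨u, hu⟩ ⟨v, hv⟩ := by
  rw [adjWords, getD_flatMap (N := n) (by simp) _ _ _ (by simpa using hu) hv]
  simp [List.getD_eq_getElem?_getD, hv]

variable {G : SimpleGraph (Fin n)} {Hs : List G.Subgraph}

theorem getD_encode_graph {u v : ℕ} (hu : u < n) (hv : v < n) :
    (encode G Hs).getD (2 + u * n + v) 0 ≠ 0 ↔ G.Adj ⟨u, hu⟩ ⟨v, hv⟩ := by
  have hlt : u * n + v < n * n := address_lt hu hv
  have he : 2 + u * n + v = (u * n + v) + 1 + 1 := by ring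
  rw [encode, he, List.getD_cons_succ, List.getD_cons_succ,
    List.getD_append _ _ _ _ (by rw [length_adjWords]; exact hlt)]
  exact getD_adjWords G.Adj hu hv

theorem getD_encode_set {i v : ℕ} (hi : i < Hs.length) (hv : v < n) :
    (encode G Hs).getD (2 + n * n + i * (n + n * n) + v) 0 ≠ 0 ↔
      (⟨v, hv⟩ : Fin n) ∈ (Hs[i]).verts := by
  have he : 2 + n * n + i * (n + n * n) + v = (n * n + (i * (n + n * n) + v)) + 1 + 1 := by ring
  rw [encode, he, List.getD_cons_succ, List.getD_cons_succ,
    List.getD_append_right _ _ _ _ (by rw [length_adjWords]; omega), length_adjWords,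
    Nat.add_sub_cancel_left, getD_flatMap (N := n + n * n)
      (fun H => by rw [List.length_append, length_vertexWords, length_adjWords]) _ _ _ hi
      (by omega),
    List.getD_append _ _ _ _ (by rw [length_vertexWords]; exact hv)]
  exact getD_vertexWords _ hv

theorem getD_encode_le_one {i : ℕ} (hi : 2 ≤ i) : (encode G Hs).getD i 0 ≤ 1 := by
  obtain ⟨j, rfl⟩ : ∃ j, i = j + 1 + 1 := ⟨i - 2, by omega⟩
  have hadj : ∀ (R : Fin n → Fin n → Prop), ∀ x ∈ adjWords R, x ≤ 1 := by
    intro R x hx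
    simp only [adjWords, List.mem_flatMap, List.mem_map] at hx
    obtain ⟨u, -, v, -, rfl⟩ := hx
    split <;> simp
  have hvert : ∀ S : Set (Fin n), ∀ x ∈ vertexWords S, x ≤ 1 := by
    intro S x hx
    simp only [vertexWords, List.mem_map] at hx
    obtain ⟨v, -, rfl⟩ := hx
    split <;> simp
  rw [encode, List.getD_cons_succ, List.getD_cons_succ, List.getD_eq_getElem?_getD]
  rcases hx : (adjWords G.Adj ++ Hs.flatMap fun H => vertexWords H.verts ++ adjWords H.Adj)[j]?
    with _ | x
  · simp
  · have := List.mem_of_getElem? hx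
    simp only [List.mem_append, List.mem_flatMap] at this
    rcases this with h | ⟨H, -, h | h⟩
    · exact hadj _ _ h
    · exact hvert _ _ h
    · exact hadj _ _ h

end

/-! ### Independent cuts and labellings -/

/-- An independent cut amounts to a labelling without clashes that uses both sides. -/
theorem hasIndependentCut_iff {V : Type*} (G : SimpleGraph V) :
    HasIndependentCut G ↔ ∃ f : V → Fin 3, (∀ u v, G.Adj u v → clash (f u) (f v) = false) ∧
      (∃ a, f a = 0) ∧ ∃ b, f b = 1 := by
  classical
  constructor
  · rintro ⟨S, hS, hcon⟩
    simp only [SimpleGraph.Preconnected, not_forall] at hcon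
    obtain ⟨x, y, hxy⟩ := hcon
    let f : V → Fin 3 := fun v => if h : v ∈ Sᶜ then
      (if (G.induce Sᶜ).Reachable x ⟨v, h⟩ then 0 else 1) else 2
    refine ⟨f, fun u v huv => ?_, ⟨x, by simp [f, show (x : V) ∉ S from x.2]⟩,
      ⟨y, by simp [f, show (y : V) ∉ S from y.2, hxy]⟩⟩
    by_cases hu : u ∈ S
    · by_cases hv : v ∈ S
      · exact absurd huv (hS hu hv huv.ne)
      · simp only [f, Set.mem_compl_iff, hu, hv, not_true, not_false_eq_true, dite_true, dite_false]
        split <;> decide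
    · by_cases hv : v ∈ S
      · simp only [f, Set.mem_compl_iff, hu, hv, not_true, not_false_eq_true, dite_true, dite_false]
        split <;> decide
      · have hadj : (G.induce Sᶜ).Adj ⟨u, hu⟩ ⟨v, hv⟩ := huv
        have : (G.induce Sᶜ).Reachable x ⟨u, hu⟩ ↔ (G.induce Sᶜ).Reachable x ⟨v, hv⟩ :=
          ⟨fun h => h.trans hadj.reachable, fun h => h.trans hadj.symm.reachable⟩
        simp only [f, Set.mem_compl_iff, hu, hv, not_false_eq_true, dite_true, this]
        split <;> decide
  · rintro ⟨f, hf, ⟨a, ha⟩, b, hb⟩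
    refine ⟨{v | f v = 2}, fun u hu v hv _ huv => ?_, fun hcon => ?_⟩
    · have := hf u v huv
      rw [show f u = 2 from hu, show f v = 2 from hv] at this
      simp [clash] at this
    · obtain ⟨w⟩ := hcon ⟨a, by simp [ha]⟩ ⟨b, by simp [hb]⟩
      have key : ∀ x y : ({v | f v = 2}ᶜ : Set V), (G.induce ({v | f v = 2}ᶜ)).Walk x y →
          f x = 0 → f y = 0 := by
        intro x y w
        induction w with
        | nil => exact id
        | @cons u v _ h _ ih =>
          intro hu
          apply ih
          have h1 := hf u v h
          have h2 : f v ≠ 2 := v.2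
          revert h1 h2
          rw [hu]
          generalize f v = c
          revert c
          decide
      have := key _ _ w ha
      simp [hb] at this

/-- A solid subgraph does not meet both sides. -/
theorem IsSolid.eq_of_side {V : Type*} {G : SimpleGraph V} {H : G.Subgraph} (hH : IsSolid H.coe)
    {f : V → Fin 3} (hf : ∀ u v, G.Adj u v → clash (f u) (f v) = false) {x y : V}
    (hx : x ∈ H.verts) (hy : y ∈ H.verts) (hfx : f x = 0) : f y ≠ 1 := fun hfy =>
  hH.2 ((hasIndependentCut_iff _).2 ⟨fun v => f v, fun u v huv => hf u v (H.adj_sub huv),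
    ⟨⟨x, hx⟩, hfx⟩, ⟨⟨y, hy⟩, hfy⟩⟩)

/-! ### The running time -/

/-- A bound on the cost of the driver. The number `m` of subgraphs, which need not be polynomial in
`n`, enters through its binary length only, which is at most `2 ^ m`. -/
theorem cost_le {n m k ds bs C D : ℕ} (hn : 3 ≤ n) (hkm : k ≤ m) (hkn : k ≤ n)
    (hds : ds ≤ C * (n + 1) ^ D) (hbs : bs ≤ C * (n + 1) ^ D) (hD : 2 ≤ D) :
    let B := 2 ^ k + (n + 1) * (n + 1) + (2 + ds + bs + n)
    2 * unitCost (max B m) + unitCost B * (15 + 5 * (n + 1) + 3 * k + ds + 2 ^ k * (2 + bs)) ≤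
      2 ^ m * n ^ ((20 + 10 * C) * (20 + 10 * C) * 2 + 4 * D) := by
  intro B
  set X := (n + 1) ^ D with hX
  have hX2 : (n + 1) * (n + 1) ≤ X := by
    rw [← pow_two]
    exact Nat.pow_le_pow_right (by omega) hD
  have hnX : n + 1 ≤ X := (Nat.le_mul_self _).trans hX2
  set Q := 5 * X + 2 * (C * X) with hQ
  have hk1 : 1 ≤ 2 ^ k := Nat.one_le_two_pow
  have hBQ : B < 2 ^ (k + Q) := by
    have h1 : (n + 1) * (n + 1) + (2 + ds + bs + n) + 1 ≤ Q := by omega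
    have h2 : Q < 2 ^ Q := Nat.lt_two_pow_self
    rw [pow_add]
    calc B < 2 ^ k + Q := by simp only [B]; omega
      _ ≤ 2 ^ k * (1 + Q) := by rw [Nat.mul_add]; nlinarith
      _ ≤ 2 ^ k * 2 ^ Q := Nat.mul_le_mul_left _ (by omega)
  have hsize : B.size ≤ n + Q := (Nat.size_le.2 hBQ).trans (by omega)
  have hmsize : (max B m).size ≤ n + Q + m := by
    rcases le_total B m with h | h
    · rw [max_eq_right h]
      exact (Nat.size_le.2 Nat.lt_two_pow_self).trans (by omega)
    · rw [max_eq_left h]; omega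
  have hmm : m ≤ 2 ^ m := Nat.lt_two_pow_self.le
  have h1m : 1 ≤ 2 ^ m := Nat.one_le_two_pow
  have hpow : 2 ^ k ≤ 2 ^ m := Nat.pow_le_pow_right (by norm_num) hkm
  set Y := (20 + 10 * C) * X with hY
  have hYe : Y = 20 * X + 10 * (C * X) := by rw [hY]; ring
  have hU : unitCost B ≤ Y := by simp only [unitCost]; omega
  have hU' : unitCost (max B m) ≤ Y + 2 * m := by simp only [unitCost]; omega
  have hY1 : 1 ≤ Y := by omega
  have hT : 15 + 5 * (n + 1) + 3 * k + ds + 2 ^ k * (2 + bs) ≤ 2 ^ m * (30 * X + 2 * (C * X)) := by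
    calc 15 + 5 * (n + 1) + 3 * k + ds + 2 ^ k * (2 + bs)
        ≤ (28 * X + C * X) + 2 ^ m * (2 * X + C * X) := by
          refine Nat.add_le_add (by omega) (Nat.mul_le_mul hpow (by omega))
      _ ≤ 2 ^ m * (28 * X + C * X) + 2 ^ m * (2 * X + C * X) :=
          Nat.add_le_add_right (Nat.le_mul_of_pos_left _ h1m) _
      _ = _ := by ring
  have hfin : 2 * unitCost (max B m) + unitCost B *
      (15 + 5 * (n + 1) + 3 * k + ds + 2 ^ k * (2 + bs)) ≤ 2 ^ m * (2 * (Y * Y)) := by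
    have h1 : 2 * unitCost (max B m) ≤ 2 ^ m * (6 * Y) := by
      have : 2 * Y ≤ 2 ^ m * (2 * Y) := Nat.le_mul_of_pos_left _ h1m
      have h2 : 4 * m ≤ 2 ^ m * (4 * Y) := by nlinarith
      calc 2 * unitCost (max B m) ≤ 2 * Y + 4 * m := by omega
        _ ≤ 2 ^ m * (2 * Y) + 2 ^ m * (4 * Y) := Nat.add_le_add this h2
        _ = _ := by ring
    have h3 : 30 * X + 2 * (C * X) + 6 ≤ 2 * Y := by omega
    calc _ ≤ 2 ^ m * (6 * Y) + Y * (2 ^ m * (30 * X + 2 * (C * X))) :=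
          Nat.add_le_add h1 (Nat.mul_le_mul hU hT)
      _ = 2 ^ m * (Y * (30 * X + 2 * (C * X) + 6)) := by ring
      _ ≤ 2 ^ m * (Y * (2 * Y)) := Nat.mul_le_mul_left _ (Nat.mul_le_mul_left _ h3)
      _ = _ := by ring
  refine hfin.trans (Nat.mul_le_mul_left _ ?_)
  set K := (20 + 10 * C) * (20 + 10 * C) * 2 with hK
  have hXn : X ≤ n ^ (2 * D) := by
    rw [hX, pow_mul]
    exact Nat.pow_le_pow_left (by nlinarith) D
  calc 2 * (Y * Y) = K * (X * X) := by rw [hY, hK]; ring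
    _ ≤ n ^ K * (n ^ (2 * D) * n ^ (2 * D)) :=
      Nat.mul_le_mul (Nat.lt_pow_self (by omega)).le (Nat.mul_le_mul hXn hXn)
    _ = n ^ (K + 4 * D) := by rw [← pow_add, ← pow_add]; congr 1; ring

/-! ### Correctness on instances -/

section

variable {n : ℕ} {G : SimpleGraph (Fin n)} {Hs : List G.Subgraph} {k : ℕ} {σ : Store}

/-- After decoding, matrix `0` is the adjacency matrix of `G`, and matrix `1` holds the vertex sets of the
subgraphs if there are fewer than `n` of them, and the singletons otherwise. -/
structure Decoded (G : SimpleGraph (Fin n)) (Hs : List G.Subgraph) (k : ℕ) (σ : Store) : Prop where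
  graph : ∀ u v, σ.cell 0 u v = true ↔ ∃ (hu : u < n) (hv : v < n), G.Adj ⟨u, hu⟩ ⟨v, hv⟩
  sets : k < n → ∀ i v, σ.cell 1 i v = true ↔
    ∃ (hi : i < Hs.length) (hv : v < n), (⟨v, hv⟩ : Fin n) ∈ (Hs[i]).verts
  singletons : n ≤ k → ∀ i v, σ.cell 1 i v = true ↔ i < n ∧ i = v
  sides : ∀ i, σ.cell 3 n i = false
  answer : σ.cell 4 0 0 = false

theorem decoded_decode (hk : min Hs.length n = k) :
    Decoded G Hs k (decode.sem (n + 1) ((encode G Hs).getD · 0) 3 (baseVars n k) Store.init) where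
  graph u v := by
    rw [sem_decode_graph]
    exact ⟨fun ⟨hu, hv, h⟩ => ⟨hu, hv, (getD_encode_graph hu hv).1 h⟩,
      fun ⟨hu, hv, h⟩ => ⟨hu, hv, (getD_encode_graph hu hv).2 h⟩⟩
  sets hkn i v := by
    have hm : k = Hs.length := by omega
    rw [sem_decode_sets hkn, hm]
    exact ⟨fun ⟨hi, hv, h⟩ => ⟨hi, hv, (getD_encode_set hi hv).1 h⟩,
      fun ⟨hi, hv, h⟩ => ⟨hi, hv, (getD_encode_set hi hv).2 h⟩⟩
  singletons hkn i v := sem_decode_singletons hkn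
  sides i := sem_decode_of_untouched (by decide)
  answer := sem_decode_of_untouched (by decide)

theorem Decoded.isGraph (h : Decoded G Hs k σ) : σ.IsGraph where
  symm u v huv := by
    obtain ⟨hu, hv, huv⟩ := (h.graph u v).1 huv
    exact (h.graph v u).2 ⟨hv, hu, huv.symm⟩
  irrefl v := by
    by_contra hc
    obtain ⟨hu, hv, hvv⟩ := (h.graph v v).1 (Bool.eq_true_of_not_eq_false hc)
    exact hvv.ne rfl

theorem Decoded.quasiCovered {F : Finset G.Subgraph} (h : Decoded G Hs k σ)
    (hk : min Hs.length n = k) (hG : IsNonTrivial G) (hF : QuasiCovers G F)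
    (hHs : ∀ H, H ∈ Hs ↔ H ∈ F) : σ.QuasiCovered n := by
  intro v hv
  rcases lt_or_ge k n with hkn | hkn
  swap
  · exact Or.inl ⟨v, hv.le, (h.singletons hkn v v).2 ⟨hv, rfl⟩⟩
  have hcov : ∀ x : Fin n, x ∈ vertexUnion F → σ.Covered n x := by
    rintro x ⟨H, hHF, hx⟩
    obtain ⟨i, hi, rfl⟩ := List.getElem_of_mem ((hHs H).2 hHF)
    exact ⟨i, by omega, (h.sets hkn i x).2 ⟨hi, x.2, hx⟩⟩
  by_cases hvU : (⟨v, hv⟩ : Fin n) ∈ vertexUnion F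
  · exact Or.inl (hcov _ hvU)
  right
  obtain ⟨T, hT, hvT⟩ := hG.2 ⟨v, hv⟩
  obtain ⟨x, hx, y, hy, hxy⟩ := (Set.one_lt_ncard (Set.toFinite _)).1 (hF T hT)
  have hadj : ∀ a ∈ T, ∀ b ∈ T, a ≠ b → G.Adj a b := fun a ha b hb hab => hT.1 ha hb hab
  have key : ∀ x y : Fin n, x < y → x ∈ (T : Set (Fin n)) ∩ vertexUnion F →
      y ∈ (T : Set (Fin n)) ∩ vertexUnion F → ∃ x y, x < y ∧ y < n ∧ σ.Covered n x ∧
      σ.Covered n y ∧ σ.cell 0 y x = true ∧ σ.cell 0 v x = true ∧ σ.cell 0 v y = true := by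
    intro x y hxy hx hy
    have hvx : (⟨v, hv⟩ : Fin n) ≠ x := by rintro rfl; exact hvU hx.2
    have hvy : (⟨v, hv⟩ : Fin n) ≠ y := by rintro rfl; exact hvU hy.2
    exact ⟨x, y, hxy, y.2, hcov x hx.2, hcov y hy.2,
      (h.graph _ _).2 ⟨y.2, x.2, hadj y hy.1 x hx.1 hxy.ne'⟩,
      (h.graph _ _).2 ⟨hv, x.2, hadj _ hvT x hx.1 hvx⟩,
      (h.graph _ _).2 ⟨hv, y.2, hadj _ hvT y hy.1 hvy⟩⟩
  rcases lt_or_gt_of_ne hxy with hlt | hlt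
  · exact key x y hlt hx hy
  · exact key y x hlt hy hx

theorem Decoded.hasIndependentCut (h : Decoded G Hs k σ) (hl : σ.HasLabelling n) :
    HasIndependentCut G := by
  obtain ⟨f, a, b, ha, hb, hfa, hfb, hf⟩ := hl
  exact (hasIndependentCut_iff G).2 ⟨fun v => f v, fun u v huv =>
    hf u u.2.le v v.2.le ((h.graph _ _).2 ⟨u.2, v.2, huv⟩), ⟨⟨a, ha⟩, hfa⟩, ⟨⟨b, hb⟩, hfb⟩⟩

/-- In a labelling that comes from an independent cut every vertex set lies on one side. The choice of
these sides is among those that are tried. -/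
theorem Decoded.rounds_of_hasIndependentCut {inp : ℕ → ℕ} (h : Decoded G Hs k σ)
    (hk : min Hs.length n = k) (hsolid : ∀ H ∈ Hs, IsSolid H.coe) (hcut : HasIndependentCut G) :
    (iter (fun _ => round.sem (n + 1) inp 3 (baseVars n k)) (2 ^ k) σ).cell 4 0 0 = true := by
  classical
  obtain ⟨f, hf, ⟨a, ha⟩, b, hb⟩ := (hasIndependentCut_iff G).1 hcut
  let g : ℕ → Fin 3 := fun v => if hv : v < n then f ⟨v, hv⟩ else 2
  have hg : ∀ (v : ℕ) (hv : v < n), g v = f ⟨v, hv⟩ := fun v hv => dif_pos hv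
  -- the side on which the vertex set `i` lies
  let s : ℕ → Bool := fun i => decide (∃ v, σ.cell 1 i v = true ∧ g v = 1)
  refine rounds_of_labelling (n := n) rfl rfl (fun i _ => h.sides i) (f := g) a.2.le b.2.le (by simp [g])
    (by rw [hg _ a.2]; exact ha) (by rw [hg _ b.2]; exact hb) ?_ s ?_
  · intro u _ v _ huv
    obtain ⟨hu, hv, huv⟩ := (h.graph u v).1 huv
    rw [hg u hu, hg v hv]
    exact hf _ _ huv
  · intro i _ v _ hiv
    have hik : i < k := by
      rcases lt_or_ge k n with hkn | hkn
      · obtain ⟨hi, -, -⟩ := (h.sets hkn i v).1 hiv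
        omega
      · have := (h.singletons hkn i v).1 hiv
        omega
    refine ⟨hik, ?_⟩
    by_cases hs : ∃ v, σ.cell 1 i v = true ∧ g v = 1
    · obtain ⟨w, hiw, hw⟩ := hs
      have hsi : s i = true := decide_eq_true ⟨w, hiw, hw⟩
      rw [hsi, if_pos rfl]
      intro hv0
      rcases lt_or_ge k n with hkn | hkn
      · obtain ⟨hi, hv, hvH⟩ := (h.sets hkn i v).1 hiv
        obtain ⟨_, hw', hwH⟩ := (h.sets hkn i w).1 hiw
        rw [hg v hv] at hv0
        rw [hg w hw'] at hw
        exact (hsolid _ (List.getElem_mem hi)).eq_of_side hf hvH hwH hv0 hw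
      · have h1 := (h.singletons hkn i v).1 hiv
        have h2 := (h.singletons hkn i w).1 hiw
        rw [← h1.2, h2.2, hw] at hv0
        simp at hv0
    · have hsi : s i = false := decide_eq_false hs
      rw [hsi]
      exact fun hv1 => hs ⟨v, hiv, by simpa using hv1⟩

end

end IndepCut

theorem theorem1 :
    ∃ (P : IndepCut.Prog) (c : ℕ),
      ∀ (n : ℕ) (G : SimpleGraph (Fin n)) (F : Finset G.Subgraph) (Hs : List G.Subgraph),
        IndepCut.IsNonTrivial G →
        (∀ H ∈ F, IndepCut.IsSolid H.coe) →
        IndepCut.QuasiCovers G F →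
        Hs.Nodup → (∀ H, H ∈ Hs ↔ H ∈ F) →
        ∃ (t : ℕ) (s : IndepCut.State),
          IndepCut.Exec P (IndepCut.State.init (IndepCut.encode G Hs)) t s ∧
          t ≤ 2 ^ F.card * n ^ c ∧
          (IndepCut.HasIndependentCut G → s.reg 0 = 1) ∧
          (¬ IndepCut.HasIndependentCut G → s.reg 0 = 0) := by
  open IndepCut in
  classical
  obtain ⟨C₁, D₁, h₁⟩ := decode.steps_le
  obtain ⟨C₂, D₂, h₂⟩ := round.steps_le
  set C := C₁ + C₂ with hC
  set D := D₁ + D₂ + 2 with hD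
  refine ⟨driver decode round 4, (20 + 10 * C) * (20 + 10 * C) * 2 + 4 * D, ?_⟩
  intro n G F Hs hG hsolid hF hnodup hHs
  have hn : 3 ≤ n := by simpa using hG.1.1
  have hcard : F.card = Hs.length := by
    rw [← List.toFinset_card_of_nodup hnodup]
    congr 1
    ext H
    rw [List.mem_toFinset, hHs]
  obtain ⟨k, hk⟩ : ∃ k, min Hs.length n = k := ⟨_, rfl⟩
  have hds : decode.steps (n + 1) ≤ C * (n + 1) ^ D := (h₁ _ (by omega)).trans
    (Nat.mul_le_mul (by omega) (Nat.pow_le_pow_right (by omega) (by omega)))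
  have hbs : round.steps (n + 1) ≤ C * (n + 1) ^ D := (h₂ _ (by omega)).trans
    (Nat.mul_le_mul (by omega) (Nat.pow_le_pow_right (by omega) (by omega)))
  obtain ⟨t, s, hexec, ht, hs⟩ := runs_driver (w := encode G Hs) (n := n) (m := Hs.length) (k := k)
    (B := 2 ^ k + (n + 1) * (n + 1) +
      (2 + decode.steps (n + 1) + round.steps (n + 1) + n)) (decode := decode) (body := round)
    (ans := 4) rfl rfl hk (fun _ hi => getD_encode_le_one hi) wellScoped_decode wellScoped_round
    (fun σ => Cmd.sem_pos_of_readFree round _ _ σ readFree_round) ((Nat.le_add_left _ _).trans (Nat.le_add_right _ _))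
    ((Nat.le_add_right _ _).trans (Nat.le_add_right _ _)) (Nat.le_add_left _ _)
  have hdec := decoded_decode (G := G) (Hs := Hs) hk
  refine ⟨t, s, hexec, ht.trans ?_, fun hcut => ?_, fun hcut => ?_⟩
  · rw [hcard]
    exact cost_le hn (by omega) (by omega) hds hbs (by omega)
  · rw [hs, hdec.rounds_of_hasIndependentCut hk (fun H hH => hsolid H ((hHs H).1 hH)) hcut]
    rfl
  · rw [hs, Bool.toNat_eq_zero]
    by_contra hc
    exact hcut (hdec.hasIndependentCut (hasLabelling_of_rounds rfl rfl hdec.isGraph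
      (hdec.quasiCovered hk hG hF hHs) hdec.answer (Bool.eq_true_of_not_eq_false hc)))
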